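/- **Setting.** Let $1\le k\le r$. A front face of $[0,1]^r$ is a face containing the origin; $\mathcal F$ is the set of front faces, and $F^c$ is the front face complementary to $F$. Put $V=\{0,1\}^r$; for $\nu\in V$ let $F(\nu)=\{u\in[0,1]^r: u_i=0 \text{ if } \nu_i=0\}\in\mathcal F$. For a measure $c$ on $[0,1]^r$, $c_F$ denotes its projection to $F\cong[0,1]^{\dim F}$. A *copula of order $k$* is a Borel probability measure on $[0,1]^r$ whose projection to every front face of dimension $k$ is uniform. *Tail characteristic.* For $F\in\mathcal F$ the tail degree of $c_F$ is $\mathrm{td}(c_F)=\inf\{\tau\ge 0:\liminf_{s\to0+}c_F([0,s]^{\dim F})/s^{\tau}=\infty\}$, and its tail coefficient is $\mathrm{tc}(c_F)=\liminf_{s\to0+}c_F([0,s]^{\dim F})/s^{\mathrm{td}(c_F)}$ (and $0$ if $\mathrm{td}(c_F)=\infty$). *Condition $\mathrm{NC}_k$.* Maps $a\colon\mathcal F\to(0,\infty)$, $b\colon\mathcal F\to[0,\infty)$ satisfy $\mathrm{NC}_k$ if (i) $b(F)\le b(F')$ whenever $F\subset F'$; (ii) $(a(F),b(F))=(1,\dim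 F)$ whenever $\dim F\le k$; (iii) $\sum_{F'\supset F}(-1)^{\dim F'-\dim F}a(F')\ge0$ for each $F$ such that $b(F')=b(F)$ for all $F'\supsetneq F$. *Vertex copulas.* For $u\in(0,1)^r$ let $\mathcal J(u)$ be the decomposition of $[0,1]^r$ into $2^r$ boxes given by splitting the $i$-th edge at $u_i$; each of its boxes contains exactly one vertex. A vector $z\in\mathbb R^V$ represents the (signed) measure that has mass $z(\nu)$ on, and is uniform on, the box containing $\nu$. $C_k(u)$ is the set of those $z\in[0,1]^V$ that represent copulas of order $k$. *Tail nesting.* Let $c$ be a measure that is uniform on each box of a grid decomposition $\mathcal J$ of $[0,1]^r$. For $J\in\mathcal J$ let $\nu(J)\in V$ be given by $\nu(J)_i=0$ if and only if $J$ contains points with $i$-th coordinate $0$. For $z\in C_k(u)$, $\mathrm{tnest}(z,c)$ is obtained from $c$ by replacing, for every $J\in\mathcal J$, the measure $c|_J$ by $c(J)$ times the affine copy in $J$ of the product of the projection of $z$ to $F(\nu(J))^c$ with the uniform measure on $F(\nu(J))$; its grid decomposes each $J\in\mathcal J$ by an affine copy of $\mathcal J(u)$. For $z_n\in C_k(u^{(n)})$,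 $n\ge1$, put $c^1=z_1$, $c^n=\mathrm{tnest}(z_n,c^{n-1})$ and, when the limit exists, let $c^\infty=\mathrm{tnest}((z_n))$ be the weak limit of $(c^n)$; it is required to satisfy $c^\infty(J)=c^n(J)$ for each $n$ and each box $J$ of the grid of $c^n$. **Statement.** Suppose that $a\colon\mathcal F\to(0,\infty)$ and $b\colon\mathcal F\to[0,\infty)$ satisfy $\mathrm{NC}_k$ and that $b$ is increasing, i.e. $b(F)<b(F')$ for all $F\subsetneq F'$ in $\mathcal F$. Then there are $t\in(0,1)$ and a sequence $z_n\in C_k(t\mathbf 1)$, $n\ge1$, where $\mathbf 1=(1,\dots,1)$, such that $c^\infty=\mathrm{tnest}((z_n))$ exists, is a copula of order $k$, is locally piecewise uniform on $(0,1)^r$ (every point of $(0,1)^r$ has a neighbourhood in $[0,1]^r$ on which $c^\infty$ coincides with a measure that is uniform on each box of some finite decomposition of $[0,1]^r$ into boxes), and has tail characteristic exactly $(a,b)$: for every $F\in\mathcal F$, $$\mathrm{tc}(c^\infty_F)=a(F)\quad\text{and}\quad \mathrm{td}(c^\infty_F)=b(F).$$ -/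

import Mathlib

open MeasureTheory Filter Topology BoxIntegral
open scoped ENNReal NNReal

/-! ## Conventions

The unit `r`-cube is `Set.Icc 0 1` in `Fin r → ℝ`. A vertex `ν ∈ {0,1}^r` is encoded by the finset
of those `i` with `ν i = 1`, and the front face `F(ν) = {u | u i = 0 whenever ν i = 0}` is encoded by
the same finset (its set of free coordinates). Thus `dim F = F.card`, `F ⊆ F'` is inclusion of
faces, the complementary face is `Fᶜ`, the reflected vertex of `ν` is `νᶜ`, and the vertices lying
in the face `F` are the subsets of `F`.

Boxes are `BoxIntegral.Box (Fin r)`: a pair of corners `lower < upper`. The coercion of a box to a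
set is the half-open box; it differs from the closed box by a Lebesgue null set. -/

noncomputable section

namespace TailNesting

/-! ## Box measures and box decompositions -/

/-- The unit cube as a box. -/
def unitBox (r : ℕ) : Box (Fin r) where
  lower := fun _ => 0
  upper := fun _ => 1
  lower_lt_upper := fun _ => zero_lt_one

/-- The canonical affine map `ι` from the unit cube onto the box `J`. -/
def boxMap {r : ℕ} (J : Box (Fin r)) (w : Fin r → ℝ) : Fin r → ℝ :=
  fun i => J.lower i + w i * (J.upper i - J.lower i)

/-- The image of the box `I` under the canonical affine map from the unit cube onto `J`. -/
def subBox {r : ℕ} (J I : Box (Fin r)) : Box (Fin r) where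
  lower := boxMap J I.lower
  upper := boxMap J I.upper
  lower_lt_upper := fun i =>
    (add_lt_add_iff_left _).2
      (mul_lt_mul_of_pos_right (I.lower_lt_upper i) (sub_pos.2 (J.lower_lt_upper i)))

/-- The uniform probability measure on the box `J`. -/
def unifBox {r : ℕ} (J : Box (Fin r)) : Measure (Fin r → ℝ) :=
  (volume (J : Set (Fin r → ℝ)))⁻¹ • volume.restrict (J : Set (Fin r → ℝ))

/-- The (nonnegative) box measure that has mass `m J` on each box `J` of the decomposition `π` of the
unit cube and is uniform on each such box. -/
def boxMeasure {r : ℕ} (π : Prepartition (unitBox r)) (m : Box (Fin r) → ℝ≥0) :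
    Measure (Fin r → ℝ) :=
  ∑ J ∈ π.boxes, (m J : ℝ≥0∞) • unifBox J

/-- `c` is locally piecewise uniform on `E ⊆ [0,1]^r`: each point of `E` has a neighbourhood `W` in
the unit cube on which `c` coincides with some box measure. -/
def LocallyPiecewiseUniformOn {r : ℕ} (c : Measure (Fin r → ℝ)) (E : Set (Fin r → ℝ)) : Prop :=
  ∀ w ∈ E, ∃ W ∈ 𝓝[Set.Icc (0 : Fin r → ℝ) 1] w,
    ∃ (π : Prepartition (unitBox r)) (m : Box (Fin r) → ℝ≥0),
      π.IsPartition ∧ c.restrict W = (boxMeasure π m).restrict W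

/-! ## Projections to faces, copulas of order `k` -/

/-- The projection `c_F` of a measure on the cube to the front face `F` (identified with the cube
`[0,1]^F`). -/
def faceMeasure {r : ℕ} (c : Measure (Fin r → ℝ)) (F : Finset (Fin r)) : Measure (F → ℝ) :=
  c.map F.restrict

/-- A copula of order `k`: a Borel probability measure on the unit cube that projects to the uniform
probability measure on each front face of dimension `k`. -/
def IsCopulaOfOrder {r : ℕ} (k : ℕ) (c : Measure (Fin r → ℝ)) : Prop :=
  IsProbabilityMeasure c ∧ c (Set.Icc 0 1) = 1 ∧
    ∀ F : Finset (Fin r), F.card = k → faceMeasure c F = volume.restrict (Set.Icc 0 1)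

/-! ## Tail characteristic -/

/-- The tail degree of a measure on `[0,1]^ι`:
`inf {τ | liminf_{s → 0+} c([0,s]^ι) / s^τ = ∞}`, which is `∞` if there is no such `τ`. -/
def tailDegree {ι : Type*} [Fintype ι] (c : Measure (ι → ℝ)) : ℝ≥0∞ :=
  ⨅ (τ : ℝ≥0)
    (_ : liminf (fun s : ℝ => c (Set.Icc 0 (fun _ => s)) / ENNReal.ofReal (s ^ (τ : ℝ)))
      (𝓝[>] 0) = ∞), (τ : ℝ≥0∞)

open Classical in
/-- The tail coefficient `liminf_{s → 0+} c([0,s]^ι) / s^td(c)`, set to `0` if `td(c) = ∞`. -/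
def tailCoef {ι : Type*} [Fintype ι] (c : Measure (ι → ℝ)) : ℝ≥0∞ :=
  if tailDegree c = ∞ then 0
  else liminf
    (fun s : ℝ => c (Set.Icc 0 (fun _ => s)) / ENNReal.ofReal (s ^ (tailDegree c).toReal))
    (𝓝[>] 0)

/-- The tail characteristic: to each front face `F` it assigns the tail coefficient and the tail
degree of the projection `c_F`. -/
def tailChar {r : ℕ} (c : Measure (Fin r → ℝ)) (F : Finset (Fin r)) : ℝ≥0∞ × ℝ≥0∞ :=
  (tailCoef (faceMeasure c F), tailDegree (faceMeasure c F))

/-- `b` is eventually constant at the front face `F`. -/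
def EventuallyConstantAt {r : ℕ} (b : Finset (Fin r) → ℝ) (F : Finset (Fin r)) : Prop :=
  ∀ F', F ⊂ F' → b F = b F'

/-- The necessary conditions `NC_k` for a pair of functions on the front faces. -/
structure NC {r : ℕ} (k : ℕ) (a b : Finset (Fin r) → ℝ) : Prop where
  mono : ∀ F F' : Finset (Fin r), F ⊆ F' → b F ≤ b F'
  low_dim : ∀ F : Finset (Fin r), F.card ≤ k → a F = 1 ∧ b F = F.card
  alternating : ∀ F : Finset (Fin r), EventuallyConstantAt b F →
    0 ≤ ∑ F' with F ⊆ F', (-1 : ℝ) ^ (F'.card - F.card) * a F'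

/-! ## Vertex copulas -/

/-- The box containing the vertex `ν` in the vertex decomposition `𝒥(u)`, `u ∈ (0,1)^r`, which is
the product of the decompositions `{[0,u i], [u i,1]}` of the edges. -/
def vertexBox {r : ℕ} (u : Fin r → Set.Ioo (0 : ℝ) 1) (ν : Finset (Fin r)) : Box (Fin r) where
  lower := fun i => if i ∈ ν then (u i : ℝ) else 0
  upper := fun i => if i ∈ ν then 1 else (u i : ℝ)
  lower_lt_upper := fun i => by
    by_cases h : i ∈ ν
    · simpa [h] using (u i).2.2
    · simpa [h] using (u i).2.1

/-- The vertex measure on `[0,1]^r` given by `u` and by the masses `z ν` (for `z ≥ 0`). -/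
def vertexMeasure {r : ℕ} (u : Fin r → Set.Ioo (0 : ℝ) 1) (z : Finset (Fin r) → ℝ) :
    Measure (Fin r → ℝ) :=
  ∑ ν, ENNReal.ofReal (z ν) • unifBox (vertexBox u ν)

/-- The uniform copula, with respect to the vertex decomposition `𝒥(u)`. -/
def unifVertex {r : ℕ} (u : Fin r → Set.Ioo (0 : ℝ) 1) (ν : Finset (Fin r)) : ℝ :=
  ∏ i, if i ∈ ν then 1 - (u i : ℝ) else (u i : ℝ)

/-- The projection `π^F` of vertex measures along the front face `F`: the mass at the vertex `μ` of
the complementary face is the sum of the masses at the vertices of `F + μ`. -/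
def projAlong {r : ℕ} (F : Finset (Fin r)) (x : Finset (Fin r) → ℝ) (μ : Finset (Fin r)) : ℝ :=
  ∑ ρ ∈ F.powerset, x (μ ∪ ρ)

/-- `G_k(V)`: the signed vertex measures whose projection along every front face of codimension `k`
vanishes. -/
def generators (r k : ℕ) : Set (Finset (Fin r) → ℝ) :=
  {x | ∀ F : Finset (Fin r), Fᶜ.card = k → ∀ μ ⊆ Fᶜ, projAlong F x μ = 0}

/-- `C_k(u)`: the vertex copulas of order `k` with respect to `𝒥(u)`. -/
def vertexCopulas {r : ℕ} (k : ℕ) (u : Fin r → Set.Ioo (0 : ℝ) 1) : Set (Finset (Fin r) → ℝ) :=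
  {z | z - unifVertex u ∈ generators r k ∧ ∀ ν, z ν ∈ Set.Icc (0 : ℝ) 1}

/-! ## Tail nesting -/

/-- The measure obtained from `z₁` by nesting, for each box `J` of the family `S` of non-overlapping
boxes, the measure `z₂ J` into `J`: the measure `z₁` is kept outside the boxes of `S`, and on `J ∈ S`
it is replaced by the copy of `z₂ J` in `J`, scaled by `z₁ J`. -/
def nest {r : ℕ} (z₂ : Box (Fin r) → Measure (Fin r → ℝ)) (z₁ : Measure (Fin r → ℝ))
    (S : Finset (Box (Fin r))) : Measure (Fin r → ℝ) :=
  z₁.restrict (⋃ J ∈ S, (J : Set (Fin r → ℝ)))ᶜ +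
    ∑ J ∈ S, z₁ (J : Set (Fin r → ℝ)) • (z₂ J).map (boxMap J)

/-- For boxes `J` of a grid decomposition of the unit cube: the projection of `J` along the front
face `F(ν)` is the box containing the origin in the projected grid. -/
def IsOriginBoxAlong {r : ℕ} (ν : Finset (Fin r)) (J : Box (Fin r)) : Prop :=
  ∀ i ∉ ν, (0 : ℝ) ∈ Set.Icc (J.lower i) (J.upper i)

open Classical in
/-- The set `𝒥(ν)` of `o`-boxes with respect to `ν`. -/
def originBoxes {r : ℕ} (𝒥 : Finset (Box (Fin r))) (ν : Finset (Fin r)) : Finset (Box (Fin r)) :=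
  {J ∈ 𝒥 | IsOriginBoxAlong ν J ∧ ∀ μ ⊂ ν, ¬ IsOriginBoxAlong μ J}

open Classical in
/-- The vertex `ν` such that `J ∈ 𝒥(ν)`; see `mem_originBoxes_iff`. -/
def tailVertex {r : ℕ} (J : Box (Fin r)) : Finset (Fin r) :=
  {i | (0 : ℝ) ∉ Set.Icc (J.lower i) (J.upper i)}

theorem mem_originBoxes_iff {r : ℕ} {𝒥 : Finset (Box (Fin r))} {J : Box (Fin r)}
    {ν : Finset (Fin r)} : J ∈ originBoxes 𝒥 ν ↔ J ∈ 𝒥 ∧ tailVertex J = ν := by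
  classical
  have key : ∀ μ, IsOriginBoxAlong μ J ↔ tailVertex J ⊆ μ := by
    intro μ
    simp only [IsOriginBoxAlong, tailVertex, Finset.subset_iff, Finset.mem_filter,
      Finset.mem_univ, true_and]
    exact forall_congr' fun i => not_imp_comm
  simp only [originBoxes, Finset.mem_filter, key]
  refine and_congr_right fun _ => ⟨fun h => ?_, ?_⟩
  · by_contra hne
    exact h.2 _ (h.1.ssubset_of_ne hne) subset_rfl
  · rintro rfl
    exact ⟨subset_rfl, fun μ hμ h => hμ.2 h⟩

/-- The product `π^{F(ν)}(z) × unif_{F(ν)}` of the projection of `z` along `F(ν)` with the uniform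
copula on `F(ν)`, as a vertex measure with respect to `𝒥(u)`. -/
def projTimesUnif {r : ℕ} (u : Fin r → Set.Ioo (0 : ℝ) 1) (ν : Finset (Fin r))
    (z : Finset (Fin r) → ℝ) (μ : Finset (Fin r)) : ℝ :=
  projAlong ν z (μ \ ν) * ∏ i ∈ ν, if i ∈ μ then 1 - (u i : ℝ) else (u i : ℝ)

/-- Tail nesting of the vertex copula `z ∈ C_k(u)` into the grid copula `c` with grid `𝒥`: for each
vertex `ν`, the vertex copula `π^{F(ν)}(z) × unif_{F(ν)}` is nested into the boxes of `𝒥(ν)`. As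
the sets `𝒥(ν)` partition `𝒥`, all these nestings are carried out at once. -/
def tnest {r : ℕ} (u : Fin r → Set.Ioo (0 : ℝ) 1) (z : Finset (Fin r) → ℝ)
    (𝒥 : Finset (Box (Fin r))) (c : Measure (Fin r → ℝ)) : Measure (Fin r → ℝ) :=
  nest (fun J => vertexMeasure u (projTimesUnif u (tailVertex J) z)) c 𝒥

open Classical in
/-- The grids of the iterated tail nesting: the first one is the vertex decomposition `𝒥(u 0)`, and
each box of a grid is decomposed by a copy of the next vertex decomposition. -/
def tnestGrid {r : ℕ} (u : ℕ → Fin r → Set.Ioo (0 : ℝ) 1) : ℕ → Finset (Box (Fin r))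
  | 0 => Finset.univ.image (vertexBox (u 0))
  | n + 1 => (tnestGrid u n).biUnion fun J =>
      Finset.univ.image fun ν => subBox J (vertexBox (u (n + 1)) ν)

/-- The iterated tail nestings of the vertex copulas `z n ∈ C_k(u n)`, `n = 0, 1, …`. -/
def tnestSeq {r : ℕ} (u : ℕ → Fin r → Set.Ioo (0 : ℝ) 1) (z : ℕ → Finset (Fin r) → ℝ) :
    ℕ → Measure (Fin r → ℝ)
  | 0 => vertexMeasure (u 0) (z 0)
  | n + 1 => tnest (u (n + 1)) (z (n + 1)) (tnestGrid u n) (tnestSeq u z n)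

/-- `c` is the limit `tnest((z n))` of the iterated tail nestings `c^n`: the weak limit of the
probability measures `c^n`, and it agrees with `c^n` on each box of the grid of `c^n`. -/
structure IsTailNesting {r : ℕ} (u : ℕ → Fin r → Set.Ioo (0 : ℝ) 1) (z : ℕ → Finset (Fin r) → ℝ)
    (c : Measure (Fin r → ℝ)) : Prop where
  isProbabilityMeasure : IsProbabilityMeasure c
  tendsto : ∀ f : BoundedContinuousFunction (Fin r → ℝ) ℝ,
    Tendsto (fun n => ∫ x, f x ∂(tnestSeq u z n)) atTop (𝓝 (∫ x, f x ∂c))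
  apply_box : ∀ n, ∀ J ∈ tnestGrid u n, c (Box.Icc J) = tnestSeq u z n (Box.Icc J)

end TailNesting

end

/-!
A random point of the iterated tail nesting of `z 0, z 1, …` is obtained from independent random
vertices `ν_0, ν_1, …` with laws `z 0, z 1, …`: its `i`-th coordinate lies in `(t^(m+1), t^m]`, where
`m` is the first index with `i ∈ ν_m`, and is uniform there, independently of everything else.
Hence `[0, t^n]^F` has mass `∏_{j < n} P(ν_j ∩ F = ∅)`, so that the tails are governed by the
avoidance masses `avoidMass (z j) F = P(ν_j ∩ F = ∅)`. These can be prescribed arbitrarily by Möbius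
inversion (`ofAvoidMass`) as long as the resulting `z j` is nonnegative, and `z j` is a copula of
order `k` as soon as `avoidMass (z j) F = t^(dim F)` for `dim F ≤ k`.

*Measures.* Everything about the nestings is derived from the formula `nestMeas_succ_real_pi` for the
masses of product sets. A step does not change the mass of product sets that do not cut the leftmost
cells (`nestMeas_succ_real_pi_of_trivial_on_cell`), it preserves uniformity of low-dimensional
projections (`nestMeas_real_pi_of_card_le`), and `nestMeas_succ_real_cornerSet` computes the masses
of the sets `[0, s]^F`. The `n`-th and all later nestings agree on the points whose coordinates exceed
`t^n`, and the other points have mass at most `r t^n`; so the nestings converge in total variation to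
the measure `limitMeas`, which is locally piecewise uniform in the open cube.

*Tails.* As `b` is strictly increasing, for small `t` the Möbius inverse `w` of `F ↦ t^(b F)` is
strictly positive. With `w` in every step, `c([0,s]^F) / s^(b F)` becomes a function `R_F` of the
position `l` of `s = t^n (t + (1 - t) l)` between two consecutive scales, and its lower limit is the
minimum of `R_F` over `[0, 1]`, which is positive. This minimum has to be corrected by the factor
`y F = a F / min R_F`. In each of the first `N` steps the avoidance masses are therefore
multiplied by `(y F)^(1/N)`; for large `N` this is close to `1`, so that strict positivity persists.
For `dim F ≤ k` the function `R_F` is constantly `1` and no correction takes place, so that all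
vertex measures are copulas of order `k`.
-/

noncomputable section

namespace TailNesting

/-! ### Sums over vertices -/

theorem sum_prod_ite_mem {r : ℕ} (f g : Fin r → ℝ) :
    ∑ ν : Finset (Fin r), ∏ i, (if i ∈ ν then f i else g i) = ∏ i, (f i + g i) := by
  classical
  rw [Finset.prod_add]
  simp only [Finset.powerset_univ]
  refine Finset.sum_congr rfl fun ν _ => ?_
  rw [Finset.prod_ite]
  congr 1 <;> refine Finset.prod_congr ?_ fun _ _ => rfl <;> ext i <;> simp

/-- The total mass that `z` gives to the vertices `ν` with `ν i = 0` for all `i ∈ G`. -/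
def avoidMass {r : ℕ} (z : Finset (Fin r) → ℝ) (G : Finset (Fin r)) : ℝ :=
  ∑ ν with Disjoint ν G, z ν

/-- The vertex measure with prescribed avoidance masses `x`, given by Möbius inversion. -/
def ofAvoidMass {r : ℕ} (x : Finset (Fin r) → ℝ) (ν : Finset (Fin r)) : ℝ :=
  ∑ H with νᶜ ⊆ H, (-1 : ℝ) ^ (H ∩ ν).card * x H

theorem ofAvoidMass_eq_sum_prod {r : ℕ} (x : Finset (Fin r) → ℝ) (ν : Finset (Fin r)) :
    ofAvoidMass x ν = ∑ H, x H *
      ∏ i, (if i ∈ ν then (if i ∈ H then (-1 : ℝ) else 1) else (if i ∈ H then 1 else 0)) := by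
  rw [ofAvoidMass, Finset.sum_filter]
  refine Finset.sum_congr rfl fun H _ => ?_
  split_ifs with h
  · rw [mul_comm]
    congr 1
    rw [← Finset.prod_const, ← Finset.prod_subset (Finset.subset_univ (H ∩ ν))]
    · refine Finset.prod_congr rfl fun i hi => ?_
      simp only [Finset.mem_inter] at hi
      simp [hi.1, hi.2]
    · intro i _ hi
      simp only [Finset.mem_inter, not_and] at hi
      by_cases hν : i ∈ ν
      · have hH : i ∉ H := fun hH => hi hH hν
        simp [hν, hH]
      · have hH : i ∈ H := h (by simpa using hν)
        simp [hν, hH]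
  · obtain ⟨i, hi, hH⟩ := Finset.not_subset.1 h
    rw [Finset.prod_eq_zero (Finset.mem_univ i), mul_zero]
    simp only [Finset.mem_compl] at hi
    simp [hi, hH]

/-- Möbius inversion; after exchanging the sums, the inner one factorizes over the coordinates. -/
theorem avoidMass_ofAvoidMass {r : ℕ} (x : Finset (Fin r) → ℝ) (G : Finset (Fin r)) :
    avoidMass (ofAvoidMass x) G = x G := by
  classical
  have h1 : ∀ ν : Finset (Fin r), (if Disjoint ν G then ofAvoidMass x ν else 0) =
      ∑ H, x H * ∏ i, (if i ∈ ν then (if i ∈ H then (-1 : ℝ) else 1) * (if i ∈ G then 0 else 1)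
        else (if i ∈ H then 1 else 0)) := by
    intro ν
    split_ifs with h
    · rw [ofAvoidMass_eq_sum_prod]
      refine Finset.sum_congr rfl fun H _ => ?_
      congr 1
      refine Finset.prod_congr rfl fun i _ => ?_
      by_cases hi : i ∈ ν
      · have : i ∉ G := Finset.disjoint_left.1 h hi
        simp [hi, this]
      · simp [hi]
    · obtain ⟨i, hi, hG⟩ := Finset.not_disjoint_iff.1 h
      symm
      refine Finset.sum_eq_zero fun H _ => ?_
      rw [Finset.prod_eq_zero (Finset.mem_univ i), mul_zero]
      simp [hi, hG]
  rw [avoidMass, Finset.sum_filter, Finset.sum_congr rfl fun ν _ => h1 ν, Finset.sum_comm]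
  simp_rw [← Finset.mul_sum, sum_prod_ite_mem]
  rw [Finset.sum_eq_single G]
  · rw [Finset.prod_eq_one, mul_one]
    intro i _
    by_cases hi : i ∈ G <;> simp [hi]
  · intro H _ hH
    have : ∃ i, ¬ (i ∈ H ↔ i ∈ G) := by
      by_contra! h
      exact hH (Finset.ext h)
    obtain ⟨i, hi⟩ := this
    rw [Finset.prod_eq_zero (Finset.mem_univ i), mul_zero]
    by_cases h1 : i ∈ H <;> by_cases h2 : i ∈ G <;> simp_all
  · simp

/-- The expectation of a product function of a random vertex is determined by the avoidance
masses. -/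
theorem sum_mul_prod_eq_avoidMass {r : ℕ} (z : Finset (Fin r) → ℝ) (f g : Fin r → ℝ) :
    ∑ ν, z ν * ∏ i, (if i ∈ ν then f i else g i) =
      ∑ G, (∏ i, if i ∈ G then g i - f i else f i) * avoidMass z G := by
  classical
  have h : ∀ ν : Finset (Fin r), ∏ i, (if i ∈ ν then f i else g i) =
      ∑ G, if Disjoint ν G then ∏ i, (if i ∈ G then g i - f i else f i) else 0 := by
    intro ν
    have : ∀ i, (if i ∈ ν then f i else g i) = (if i ∈ ν then 0 else g i - f i) + f i := by
      intro i; split_ifs <;> ring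
    simp_rw [this]
    rw [← sum_prod_ite_mem]
    refine Finset.sum_congr rfl fun G _ => ?_
    split_ifs with hd
    · refine Finset.prod_congr rfl fun i _ => ?_
      by_cases hi : i ∈ G
      · simp [hi, Finset.disjoint_right.1 hd hi]
      · simp [hi]
    · obtain ⟨i, hi, hG⟩ := Finset.not_disjoint_iff.1 hd
      exact Finset.prod_eq_zero (Finset.mem_univ i) (by simp [hi, hG])
  simp_rw [h, avoidMass, Finset.sum_filter, Finset.mul_sum]
  rw [Finset.sum_comm]
  refine Finset.sum_congr rfl fun G _ => Finset.sum_congr rfl fun ν _ => ?_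
  split_ifs <;> ring

/-- If the avoidance masses of `z` up to dimension `k` are those of the uniform copula, then `z` and
the uniform copula agree on product functions that depend on at most `k` coordinates. -/
theorem sum_mul_prod_of_avoidMass {r k : ℕ} {t : ℝ} {z : Finset (Fin r) → ℝ}
    (hz : ∀ G : Finset (Fin r), G.card ≤ k → avoidMass z G = t ^ G.card)
    {F : Finset (Fin r)} (hF : F.card ≤ k) (f g : Fin r → ℝ) (hfg : ∀ i ∉ F, f i = g i) :
    ∑ ν, z ν * ∏ i, (if i ∈ ν then f i else g i) = ∏ i, ((1 - t) * f i + t * g i) := by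
  rw [sum_mul_prod_eq_avoidMass]
  have : ∀ i, (1 - t) * f i + t * g i = t * (g i - f i) + f i := fun i => by ring
  simp_rw [this]
  rw [← sum_prod_ite_mem]
  refine Finset.sum_congr rfl fun G _ => ?_
  by_cases hG : G ⊆ F
  · rw [hz G ((Finset.card_le_card hG).trans hF), ← Finset.prod_const, mul_comm,
      show (∏ _x ∈ G, t) = ∏ i, if i ∈ G then t else 1 by
        rw [Finset.prod_ite_mem, Finset.univ_inter], ← Finset.prod_mul_distrib]
    refine Finset.prod_congr rfl fun i _ => ?_
    split_ifs <;> simp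
  · obtain ⟨i, hi, hF⟩ := Finset.not_subset.1 hG
    rw [Finset.prod_eq_zero (Finset.mem_univ i), zero_mul, Finset.prod_eq_zero (Finset.mem_univ i)]
    · simp [hi, hfg i hF]
    · simp [hi, hfg i hF]

theorem avoidMass_empty {r : ℕ} (z : Finset (Fin r) → ℝ) : avoidMass z ∅ = ∑ ν, z ν := by
  simp [avoidMass]

theorem avoidMass_eq_sum_prod {r : ℕ} (z : Finset (Fin r) → ℝ) (G : Finset (Fin r)) :
    avoidMass z G = ∑ ν, z ν * ∏ i, (if i ∈ ν then (if i ∈ G then 0 else 1) else 1) := by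
  classical
  rw [avoidMass, Finset.sum_filter]
  refine Finset.sum_congr rfl fun ν _ => ?_
  split_ifs with hd
  · rw [Finset.prod_eq_one, mul_one]
    intro i _
    by_cases hi : i ∈ ν
    · simp [hi, Finset.disjoint_left.1 hd hi]
    · simp [hi]
  · obtain ⟨i, hi, hG⟩ := Finset.not_disjoint_iff.1 hd
    rw [Finset.prod_eq_zero (Finset.mem_univ i) (by simp [hi, hG]), mul_zero]

theorem avoidMass_unifVertex {r : ℕ} (t : Set.Ioo (0 : ℝ) 1) (G : Finset (Fin r)) :
    avoidMass (unifVertex fun _ => t) G = (t : ℝ) ^ G.card := by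
  rw [avoidMass_eq_sum_prod]
  simp_rw [unifVertex, ← Finset.prod_mul_distrib, ite_mul_ite]
  rw [sum_prod_ite_mem, ← Finset.prod_const, ← Finset.prod_subset (Finset.subset_univ G)]
  · exact Finset.prod_congr rfl fun i hi => by simp [hi]
  · intro i _ hi
    simp [hi]

/-! ### Projections of vertex measures -/

theorem projAlong_eq_sum {r : ℕ} (T : Finset (Fin r)) (z : Finset (Fin r) → ℝ)
    {μ : Finset (Fin r)} (hμ : Disjoint μ T) :
    projAlong T z μ = ∑ ν with ν \ T = μ, z ν := by
  rw [projAlong]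
  refine Finset.sum_nbij' (fun ρ => μ ∪ ρ) (fun ν => ν ∩ T) ?_ ?_ ?_ ?_ ?_
  · intro ρ hρ
    simp only [Finset.mem_powerset] at hρ
    simp [Finset.union_sdiff_distrib, Finset.sdiff_eq_self_of_disjoint hμ,
      Finset.sdiff_eq_empty_iff_subset.2 hρ]
  · simp
  · intro ρ hρ
    simp only [Finset.mem_powerset] at hρ
    rw [Finset.union_inter_distrib_right, Finset.disjoint_iff_inter_eq_empty.1 hμ,
      Finset.empty_union, Finset.inter_eq_left.2 hρ]
  · intro ν hν
    simp only [Finset.mem_filter, Finset.mem_univ, true_and] at hν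
    rw [← hν, Finset.sdiff_union_inter]
  · simp

theorem projAlong_eq_sum_prod {r : ℕ} (T : Finset (Fin r)) (z : Finset (Fin r) → ℝ)
    {μ : Finset (Fin r)} (hμ : Disjoint μ T) :
    projAlong T z μ = ∑ ν, z ν *
      ∏ i, (if i ∈ ν then (if i ∈ T ∨ i ∈ μ then 1 else 0) else (if i ∈ T ∨ i ∉ μ then 1 else 0)) := by
  classical
  rw [projAlong_eq_sum T z hμ, Finset.sum_filter]
  refine Finset.sum_congr rfl fun ν _ => ?_
  split_ifs with h
  · rw [Finset.prod_eq_one, mul_one]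
    intro i _
    have := Finset.ext_iff.1 h i
    simp only [Finset.mem_sdiff] at this
    by_cases h1 : i ∈ ν <;> by_cases h2 : i ∈ T <;> simp_all
  · have : ∃ i, ¬ (i ∈ ν \ T ↔ i ∈ μ) := by
      by_contra! h'
      exact h (Finset.ext h')
    obtain ⟨i, hi⟩ := this
    have h3 : i ∈ μ → i ∉ T := fun h => Finset.disjoint_left.1 hμ h
    rw [Finset.prod_eq_zero (Finset.mem_univ i), mul_zero]
    by_cases h1 : i ∈ ν <;> by_cases h2 : i ∈ T <;> simp_all

theorem mem_vertexCopulas_of_avoidMass {r k : ℕ} (t : Set.Ioo (0 : ℝ) 1)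
    {z : Finset (Fin r) → ℝ} (h0 : ∀ ν, 0 ≤ z ν)
    (hz : ∀ G : Finset (Fin r), G.card ≤ k → avoidMass z G = (t : ℝ) ^ G.card) :
    z ∈ vertexCopulas k (fun _ : Fin r => t) := by
  refine ⟨?_, fun ν => ⟨h0 ν, ?_⟩⟩
  · intro F hF μ hμ
    have hd : Disjoint μ F := by
      rw [Finset.disjoint_left]
      intro i hi
      simpa using hμ hi
    have hsub : projAlong F (z - unifVertex fun _ => t) μ =
        projAlong F z μ - projAlong F (unifVertex fun _ => t) μ := by
      simp [projAlong]
    rw [hsub, projAlong_eq_sum_prod F _ hd, projAlong_eq_sum_prod F _ hd,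
      sum_mul_prod_of_avoidMass hz hF.le _ _ ?_,
      sum_mul_prod_of_avoidMass (fun G _ => avoidMass_unifVertex t G) hF.le _ _ ?_, sub_self]
    all_goals
      intro i hi
      simp only [Finset.mem_compl, not_not] at hi
      simp [hi]
  · have := hz ∅ (by simp)
    rw [avoidMass_empty, Finset.card_empty, pow_zero] at this
    rw [← this]
    exact Finset.single_le_sum (fun ν _ => h0 ν) (Finset.mem_univ ν)

/-- Under `projTimesUnif T z` the coordinates in `T` are independent of each other and of the rest,
and the other coordinates have the same law as under `z`. -/
theorem sum_projTimesUnif_mul_prod {r : ℕ} (t : Set.Ioo (0 : ℝ) 1) (T : Finset (Fin r))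
    (z : Finset (Fin r) → ℝ) (f g : Fin r → ℝ) :
    ∑ μ, projTimesUnif (fun _ => t) T z μ * ∏ i, (if i ∈ μ then f i else g i) =
      ∑ ν, z ν * ∏ i, (if i ∈ T then (1 - (t : ℝ)) * f i + t * g i
        else if i ∈ ν then f i else g i) := by
  classical
  have h : ∀ μ : Finset (Fin r),
      projTimesUnif (fun _ => t) T z μ * ∏ i, (if i ∈ μ then f i else g i) =
      ∑ ν, z ν * ∏ i, (if i ∈ μ
        then (if i ∈ T then (1 - (t : ℝ)) * f i else if i ∈ ν then f i else 0)
        else (if i ∈ T then t * g i else if i ∈ ν then 0 else g i)) := by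
    intro μ
    rw [projTimesUnif, projAlong_eq_sum_prod T z Finset.sdiff_disjoint, Finset.sum_mul,
      Finset.sum_mul]
    refine Finset.sum_congr rfl fun ν _ => ?_
    rw [mul_assoc, mul_assoc]
    congr 1
    rw [show (∏ i ∈ T, if i ∈ μ then 1 - (t : ℝ) else t) =
      ∏ i, if i ∈ T then (if i ∈ μ then 1 - (t : ℝ) else t) else 1 by
        rw [Finset.prod_ite_mem, Finset.univ_inter], ← Finset.prod_mul_distrib,
      ← Finset.prod_mul_distrib]
    refine Finset.prod_congr rfl fun i _ => ?_
    by_cases h1 : i ∈ ν <;> by_cases h2 : i ∈ T <;> by_cases h3 : i ∈ μ <;> simp [h1, h2, h3]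
  simp_rw [h]
  rw [Finset.sum_comm]
  refine Finset.sum_congr rfl fun ν _ => ?_
  rw [← Finset.mul_sum, sum_prod_ite_mem]
  congr 1
  refine Finset.prod_congr rfl fun i _ => ?_
  by_cases h1 : i ∈ ν <;> by_cases h2 : i ∈ T <;> simp [h1, h2]

theorem projTimesUnif_nonneg {r : ℕ} (t : Set.Ioo (0 : ℝ) 1) (T : Finset (Fin r))
    {z : Finset (Fin r) → ℝ} (h0 : ∀ ν, 0 ≤ z ν) (μ : Finset (Fin r)) :
    0 ≤ projTimesUnif (fun _ => t) T z μ := by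
  refine mul_nonneg (Finset.sum_nonneg fun ρ _ => h0 _) (Finset.prod_nonneg fun i _ => ?_)
  split_ifs
  · exact sub_nonneg.2 t.2.2.le
  · exact t.2.1.le

/-! ### Uniform measures on boxes and their product form -/

/-- The probability of `S` under the uniform distribution on the interval `(l, u]`. -/
def cellProb (l u : ℝ) (S : Set ℝ) : ℝ := volume.real (S ∩ Set.Ioc l u) / (u - l)

theorem cellProb_of_subset {l u : ℝ} (h : l < u) {S : Set ℝ} (hS : Set.Ioc l u ⊆ S) :
    cellProb l u S = 1 := by
  rw [cellProb, Set.inter_eq_right.2 hS, Real.volume_real_Ioc_of_le h.le,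
    div_self (sub_pos.2 h).ne']

theorem cellProb_of_null {l u : ℝ} {S : Set ℝ} (hS : volume (S ∩ Set.Ioc l u) = 0) :
    cellProb l u S = 0 := by
  rw [cellProb, measureReal_def, hS, ENNReal.toReal_zero, zero_div]

theorem cellProb_average {l u t : ℝ} (ht0 : 0 < t) (ht1 : t < 1) (h : l < u) {S : Set ℝ}
    (hS : MeasurableSet S) :
    (1 - t) * cellProb (l + t * (u - l)) u S + t * cellProb l (l + t * (u - l)) S =
      cellProb l u S := by
  have hd : 0 < u - l := sub_pos.2 h
  have h1 : l ≤ l + t * (u - l) := by nlinarith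
  have h2 : l + t * (u - l) ≤ u := by nlinarith
  have hsplit : volume.real (S ∩ Set.Ioc l u) = volume.real (S ∩ Set.Ioc l (l + t * (u - l))) +
      volume.real (S ∩ Set.Ioc (l + t * (u - l)) u) := by
    rw [← Set.Ioc_union_Ioc_eq_Ioc h1 h2, Set.inter_union_distrib_left]
    refine measureReal_union ?_ (hS.inter measurableSet_Ioc) ?_ ?_
    · exact (Set.Ioc_disjoint_Ioc_of_le le_rfl).mono Set.inter_subset_right Set.inter_subset_right
    · exact (measure_mono Set.inter_subset_right).trans_lt measure_Ioc_lt_top |>.ne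
    · exact (measure_mono Set.inter_subset_right).trans_lt measure_Ioc_lt_top |>.ne
  rw [cellProb, cellProb, cellProb, hsplit]
  have e1 : u - (l + t * (u - l)) = (1 - t) * (u - l) := by ring
  have e2 : l + t * (u - l) - l = t * (u - l) := by ring
  have h3 : (1 - t) ≠ 0 := (sub_pos.2 ht1).ne'
  rw [e1, e2]
  field_simp
  ring

theorem cellProb_preimage {c d l u : ℝ} (hd : 0 < d) (S : Set ℝ) :
    cellProb l u ((fun x => c + x * d) ⁻¹' S) = cellProb (c + l * d) (c + u * d) S := by
  have h : ((fun x => c + x * d) ⁻¹' S) ∩ Set.Ioc l u =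
      (fun x => x * d) ⁻¹' ((fun x => c + x) ⁻¹' (S ∩ Set.Ioc (c + l * d) (c + u * d))) := by
    ext x
    simp [mul_le_mul_iff_left₀ hd, mul_lt_mul_iff_left₀ hd]
  rw [cellProb, cellProb, h, measureReal_def, Real.volume_preimage_mul_right hd.ne',
    measure_preimage_add, ENNReal.toReal_mul, ENNReal.toReal_ofReal (abs_nonneg _),
    abs_of_pos (inv_pos.2 hd), measureReal_def,
    show c + u * d - (c + l * d) = d * (u - l) by ring, inv_mul_eq_div, div_div]

variable {r : ℕ}

theorem volume_box_ne_zero (J : Box (Fin r)) : volume (J : Set (Fin r → ℝ)) ≠ 0 := by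
  rw [Box.coe_eq_pi, Real.volume_pi_Ioc, Finset.prod_ne_zero_iff]
  intro i _
  simp

theorem volume_box_ne_top (J : Box (Fin r)) : volume (J : Set (Fin r → ℝ)) ≠ ∞ := by
  rw [Box.coe_eq_pi, Real.volume_pi_Ioc]
  exact ENNReal.prod_ne_top fun i _ => ENNReal.ofReal_ne_top

instance isProbabilityMeasure_unifBox (J : Box (Fin r)) :
    IsProbabilityMeasure (unifBox J) :=
  ⟨by rw [unifBox, Measure.smul_apply, Measure.restrict_apply_univ, smul_eq_mul,
    ENNReal.inv_mul_cancel (volume_box_ne_zero J) (volume_box_ne_top J)]⟩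

theorem unifBox_apply_self (J : Box (Fin r)) : unifBox J (J : Set (Fin r → ℝ)) = 1 := by
  rw [unifBox, Measure.smul_apply, Measure.restrict_apply J.measurableSet_coe, Set.inter_self,
    smul_eq_mul, ENNReal.inv_mul_cancel (volume_box_ne_zero J) (volume_box_ne_top J)]

theorem unifBox_restrict_self (J : Box (Fin r)) : (unifBox J).restrict J = unifBox J := by
  rw [unifBox, Measure.restrict_smul, Measure.restrict_restrict J.measurableSet_coe,
    Set.inter_self]

theorem unifBox_restrict_of_disjoint {J : Box (Fin r)} {S : Set (Fin r → ℝ)}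
    (h : Disjoint (J : Set (Fin r → ℝ)) S) (hS : MeasurableSet S) : (unifBox J).restrict S = 0 := by
  rw [unifBox, Measure.restrict_smul, Measure.restrict_restrict hS, Set.inter_comm,
    h.inter_eq, Measure.restrict_empty, smul_zero]

theorem unifBox_real_pi (J : Box (Fin r)) {A : Fin r → Set ℝ} (hA : ∀ i, MeasurableSet (A i)) :
    (unifBox J).real (Set.univ.pi A) = ∏ i, cellProb (J.lower i) (J.upper i) (A i) := by
  rw [measureReal_def, unifBox, Measure.smul_apply,
    Measure.restrict_apply (MeasurableSet.univ_pi hA), Box.coe_eq_pi, ← Set.pi_inter_distrib,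
    volume_pi_pi, volume_pi_pi, smul_eq_mul, ENNReal.toReal_mul, ENNReal.toReal_inv,
    ENNReal.toReal_prod, ENNReal.toReal_prod, ← Finset.prod_inv_distrib, ← Finset.prod_mul_distrib]
  refine Finset.prod_congr rfl fun i _ => ?_
  rw [Real.volume_Ioc, ENNReal.toReal_ofReal (sub_nonneg.2 (J.lower_le_upper i)), cellProb,
    inv_mul_eq_div]
  rfl

/-- Finite measures on `ℝ^r` are determined by their values on measurable product sets. -/
theorem measure_ext_of_real_pi {μ ν : Measure (Fin r → ℝ)} [IsFiniteMeasure μ] [IsFiniteMeasure ν]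
    (h : ∀ A : Fin r → Set ℝ, (∀ i, MeasurableSet (A i)) →
      μ.real (Set.univ.pi A) = ν.real (Set.univ.pi A)) : μ = ν := by
  have h' : ∀ A : Fin r → Set ℝ, (∀ i, MeasurableSet (A i)) →
      μ (Set.univ.pi A) = ν (Set.univ.pi A) := fun A hA =>
    (ENNReal.toReal_eq_toReal_iff' (measure_ne_top _ _) (measure_ne_top _ _)).1 (h A hA)
  refine ext_of_generate_finite _ generateFrom_pi.symm isPiSystem_pi ?_ ?_
  · rintro _ ⟨A, hA, rfl⟩
    exact h' A fun i => hA i trivial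
  · simpa using h' (fun _ => Set.univ) fun _ => MeasurableSet.univ

theorem measurable_boxMap (J : Box (Fin r)) : Measurable (boxMap J) := by
  unfold boxMap
  fun_prop

theorem map_boxMap_unifBox (J I : Box (Fin r)) :
    (unifBox I).map (boxMap J) = unifBox (subBox J I) := by
  have : IsProbabilityMeasure ((unifBox I).map (boxMap J)) :=
    Measure.isProbabilityMeasure_map (measurable_boxMap J).aemeasurable
  refine measure_ext_of_real_pi fun A hA => ?_
  have hpre : boxMap J ⁻¹' Set.univ.pi A = Set.univ.pi fun i =>
      (fun x => J.lower i + x * (J.upper i - J.lower i)) ⁻¹' A i := by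
    ext w
    simp [boxMap]
  rw [map_measureReal_apply (measurable_boxMap J) (MeasurableSet.univ_pi hA), hpre,
    unifBox_real_pi _ hA, unifBox_real_pi]
  · exact Finset.prod_congr rfl fun i _ =>
      cellProb_preimage (sub_pos.2 (J.lower_lt_upper i)) _
  · intro i
    exact (by fun_prop : Measurable fun x => J.lower i + x * (J.upper i - J.lower i)) (hA i)

/-! ### The grids as partitions of the unit cube -/

variable (t : Set.Ioo (0 : ℝ) 1)

/-- The box of the vertex decomposition of `J` that contains the vertex `ν` of `J`; every edge is
split in the proportion `t : 1 - t`. -/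
def vertexSubBox (J : Box (Fin r)) (ν : Finset (Fin r)) : Box (Fin r) :=
  subBox J (vertexBox (fun _ => t) ν)

/-- The point at which the `i`-th edge of `J` is split. -/
def splitPoint (J : Box (Fin r)) (i : Fin r) : ℝ := J.lower i + t * (J.upper i - J.lower i)

theorem lower_lt_splitPoint (J : Box (Fin r)) (i : Fin r) : J.lower i < splitPoint t J i :=
  lt_add_of_pos_right _ (mul_pos t.2.1 (sub_pos.2 (J.lower_lt_upper i)))

theorem splitPoint_lt_upper (J : Box (Fin r)) (i : Fin r) : splitPoint t J i < J.upper i := by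
  have := mul_lt_mul_of_pos_right t.2.2 (sub_pos.2 (J.lower_lt_upper i))
  rw [splitPoint]
  linarith

theorem vertexSubBox_lower (J : Box (Fin r)) (ν : Finset (Fin r)) (i : Fin r) :
    (vertexSubBox t J ν).lower i = if i ∈ ν then splitPoint t J i else J.lower i := by
  simp only [vertexSubBox, subBox, boxMap, vertexBox, splitPoint]
  split_ifs <;> ring

theorem vertexSubBox_upper (J : Box (Fin r)) (ν : Finset (Fin r)) (i : Fin r) :
    (vertexSubBox t J ν).upper i = if i ∈ ν then J.upper i else splitPoint t J i := by
  simp only [vertexSubBox, subBox, boxMap, vertexBox, splitPoint]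
  split_ifs <;> ring

theorem vertexSubBox_le (J : Box (Fin r)) (ν : Finset (Fin r)) : vertexSubBox t J ν ≤ J := by
  rw [Box.le_iff_bounds]
  refine ⟨fun i => ?_, fun i => ?_⟩
  · rw [vertexSubBox_lower]
    split_ifs
    exacts [(lower_lt_splitPoint t J i).le, le_rfl]
  · rw [vertexSubBox_upper]
    split_ifs
    exacts [le_rfl, (splitPoint_lt_upper t J i).le]

theorem vertexSubBox_unitBox (ν : Finset (Fin r)) :
    vertexSubBox t (unitBox r) ν = vertexBox (fun _ => t) ν := by
  refine Box.ext fun x => ?_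
  simp [vertexSubBox, Box.mem_def, subBox, boxMap, unitBox]

/-- The vertex decomposition of the box `J`. -/
def vertexPartition (J : Box (Fin r)) : Prepartition J where
  boxes := by classical exact Finset.univ.image (vertexSubBox t J)
  le_of_mem' K hK := by
    simp only [Finset.mem_image, Finset.mem_univ, true_and] at hK
    obtain ⟨ν, rfl⟩ := hK
    exact vertexSubBox_le t J ν
  pairwiseDisjoint := by
    intro K hK L hL hne
    simp only [Finset.coe_image, Finset.coe_univ, Set.image_univ, Set.mem_range] at hK hL
    obtain ⟨ν, rfl⟩ := hK
    obtain ⟨μ, rfl⟩ := hL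
    rw [Function.onFun, Set.disjoint_left]
    intro x h1 h2
    refine hne ?_
    congr 1
    ext i
    have h1 := (vertexSubBox t J ν).mem_def.1 h1 i
    have h2 := (vertexSubBox t J μ).mem_def.1 h2 i
    rw [vertexSubBox_lower, vertexSubBox_upper] at h1 h2
    by_cases hν : i ∈ ν <;> by_cases hμ : i ∈ μ <;> simp only [hν, hμ, if_true, if_false] at h1 h2 ⊢
    · exact absurd h1.1 (not_lt.2 h2.2)
    · exact absurd h2.1 (not_lt.2 h1.2)

theorem mem_vertexPartition {J K : Box (Fin r)} :
    K ∈ vertexPartition t J ↔ ∃ ν, vertexSubBox t J ν = K := by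
  simp [vertexPartition, ← Prepartition.mem_boxes]

theorem vertexPartition_isPartition (J : Box (Fin r)) : (vertexPartition t J).IsPartition := by
  classical
  intro x hx
  refine ⟨_, (mem_vertexPartition t).2 ⟨({i | splitPoint t J i < x i} : Finset (Fin r)), rfl⟩, ?_⟩
  rw [Box.mem_def]
  intro i
  have h := J.mem_def.1 hx i
  rw [vertexSubBox_lower, vertexSubBox_upper]
  by_cases h1 : splitPoint t J i < x i
  · simpa [h1] using h.2
  · simpa [h1] using ⟨h.1, not_lt.1 h1⟩

/-- The partitions of the unit cube underlying the iterated tail nesting, starting with the trivial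
partition. -/
def gridPartition (r : ℕ) (t : Set.Ioo (0 : ℝ) 1) : ℕ → Prepartition (unitBox r)
  | 0 => ⊤
  | n + 1 => (gridPartition r t n).biUnion (vertexPartition t)

theorem gridPartition_isPartition (n : ℕ) : (gridPartition r t n).IsPartition := by
  induction n with
  | zero => exact Prepartition.isPartitionTop _
  | succ n ih => exact ih.biUnion fun J _ => vertexPartition_isPartition t J

theorem mem_gridPartition_succ {n : ℕ} {K : Box (Fin r)} :
    K ∈ gridPartition r t (n + 1) ↔ ∃ J ∈ gridPartition r t n, ∃ ν, vertexSubBox t J ν = K := by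
  simp only [gridPartition, Prepartition.mem_biUnion, mem_vertexPartition]

theorem gridPartition_boxes_succ (n : ℕ) :
    (gridPartition r t (n + 1)).boxes = tnestGrid (fun _ _ => t) n := by
  induction n with
  | zero =>
    ext K
    simp [gridPartition, tnestGrid, mem_vertexPartition, vertexSubBox_unitBox]
  | succ n ih =>
    ext K
    simp only [Prepartition.mem_boxes, mem_gridPartition_succ t (n := n + 1), tnestGrid,
      Finset.mem_biUnion, Finset.mem_image, Finset.mem_univ, true_and, ← ih, vertexSubBox]

/-- In every coordinate a box of the `n`-th grid is either the leftmost cell `(0, t^n]` or lies to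
the right of it. -/
theorem gridPartition_cases {n : ℕ} {J : Box (Fin r)} (hJ : J ∈ gridPartition r t n) (i : Fin r) :
    (i ∉ tailVertex J ∧ J.lower i = 0 ∧ J.upper i = (t : ℝ) ^ n) ∨
      (i ∈ tailVertex J ∧ (t : ℝ) ^ n ≤ J.lower i) := by
  have ht0 : (0 : ℝ) < t := t.2.1
  suffices h : (J.lower i = 0 ∧ J.upper i = (t : ℝ) ^ n) ∨ (t : ℝ) ^ n ≤ J.lower i by
    rcases h with ⟨h1, h2⟩ | h
    · refine Or.inl ⟨?_, h1, h2⟩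
      simp [tailVertex, h1, h2, (pow_pos ht0 n).le]
    · refine Or.inr ⟨?_, h⟩
      simp [tailVertex, (pow_pos ht0 n).trans_le h]
  induction n generalizing J with
  | zero =>
    simp only [gridPartition, Prepartition.mem_top] at hJ
    simp [hJ, unitBox]
  | succ n ih =>
    obtain ⟨J, hJ', ν, rfl⟩ := (mem_gridPartition_succ t).1 hJ
    have hp : (t : ℝ) ^ (n + 1) ≤ (t : ℝ) ^ n := pow_le_pow_of_le_one ht0.le t.2.2.le n.le_succ
    rw [vertexSubBox_lower, vertexSubBox_upper]
    rcases ih hJ' with ⟨h1, h2⟩ | h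
    · have hs : splitPoint t J i = (t : ℝ) ^ (n + 1) := by
        rw [splitPoint, h1, h2]
        ring
      split_ifs
      · exact Or.inr hs.ge
      · exact Or.inl ⟨h1, hs⟩
    · right
      split_ifs
      · exact (hp.trans h).trans (lower_lt_splitPoint t J i).le
      · exact hp.trans h

/-! ### The iterated tail nestings -/

theorem map_finsetSum_smul {ι : Type*} (s : Finset ι) (w : ι → ℝ≥0∞)
    (μ : ι → Measure (Fin r → ℝ)) {f : (Fin r → ℝ) → (Fin r → ℝ)} (hf : Measurable f) :
    (∑ i ∈ s, w i • μ i).map f = ∑ i ∈ s, w i • (μ i).map f := by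
  rw [← Measure.mapₗ_apply_of_measurable hf, map_sum]
  simp [Measure.mapₗ_apply_of_measurable hf]

theorem restrict_finsetSum_smul {ι : Type*} (s : Finset ι) (w : ι → ℝ≥0∞)
    (μ : ι → Measure (Fin r → ℝ)) (S : Set (Fin r → ℝ)) :
    (∑ i ∈ s, w i • μ i).restrict S = ∑ i ∈ s, w i • (μ i).restrict S := by
  rw [← Measure.restrictₗ_apply, map_sum]
  simp

/-- The copy in `J` of the vertex measure that tail nesting of `z` puts there; a probability measure
if `z` is a nonnegative vertex measure of total mass `1`. -/
def nestInBox (z : Finset (Fin r) → ℝ) (J : Box (Fin r)) : Measure (Fin r → ℝ) :=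
  ∑ μ, ENNReal.ofReal (projTimesUnif (fun _ => t) (tailVertex J) z μ) •
    unifBox (vertexSubBox t J μ)

/-- The iterated tail nestings, preceded by the uniform measure on the unit cube: the index is the
number of nesting steps, so that `tnestSeq` at `n` is `nestMeas` at `n + 1`. -/
def nestMeas (z : ℕ → Finset (Fin r) → ℝ) : ℕ → Measure (Fin r → ℝ)
  | 0 => unifBox (unitBox r)
  | n + 1 => tnestSeq (fun _ _ => t) z n

theorem nestInBox_compl (z : Finset (Fin r) → ℝ) {J : Box (Fin r)} (hJ : J ≤ unitBox r) :
    nestInBox t z J (unitBox r : Set (Fin r → ℝ))ᶜ = 0 := by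
  rw [nestInBox, Measure.finsetSum_apply]
  refine Finset.sum_eq_zero fun μ _ => ?_
  have h : unifBox (vertexSubBox t J μ) (vertexSubBox t J μ : Set (Fin r → ℝ))ᶜ = 0 :=
    (prob_compl_eq_zero_iff (vertexSubBox t J μ).measurableSet_coe).2 (unifBox_apply_self _)
  rw [Measure.smul_apply, smul_eq_mul, measure_mono_null (Set.compl_subset_compl.2
    (Box.coe_subset_coe.2 ((vertexSubBox_le t J μ).trans hJ))) h, mul_zero]

/-- The recursion for the nestings, together with the fact that they live on the half-open unit cube;
the latter is what makes the first summand in the definition of `nest` vanish. -/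
theorem nestMeas_succ_and_compl (z : ℕ → Finset (Fin r) → ℝ) (n : ℕ) :
    nestMeas t z (n + 1) = ∑ J ∈ (gridPartition r t n).boxes, nestMeas t z n J • nestInBox t (z n) J
      ∧ nestMeas t z (n + 1) (unitBox r : Set (Fin r → ℝ))ᶜ = 0 := by
  have hnull : ∀ n, nestMeas t z (n + 1) =
      ∑ J ∈ (gridPartition r t n).boxes, nestMeas t z n J • nestInBox t (z n) J →
      nestMeas t z (n + 1) (unitBox r : Set (Fin r → ℝ))ᶜ = 0 := by
    intro n h
    rw [h, Measure.finsetSum_apply]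
    refine Finset.sum_eq_zero fun J hJ => ?_
    rw [Measure.smul_apply, nestInBox_compl t _ (Prepartition.le_of_mem _ hJ), smul_zero]
  suffices h : nestMeas t z (n + 1) =
      ∑ J ∈ (gridPartition r t n).boxes, nestMeas t z n J • nestInBox t (z n) J from
    ⟨h, hnull n h⟩
  induction n with
  | zero =>
    have hT : tailVertex (unitBox r) = ∅ := by
      ext i
      simp [tailVertex, unitBox]
    simp only [gridPartition, Prepartition.top_boxes, Finset.sum_singleton, nestMeas,
      unifBox_apply_self, one_smul, tnestSeq, vertexMeasure, nestInBox, vertexSubBox_unitBox, hT]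
    refine Finset.sum_congr rfl fun μ _ => ?_
    simp [projTimesUnif, projAlong]
  | succ n ih =>
    have hU : (⋃ J ∈ (gridPartition r t (n + 1)).boxes, (J : Set (Fin r → ℝ))) = unitBox r :=
      (gridPartition_isPartition t (n + 1)).iUnion_eq
    have h0 := hnull n ih
    change tnestSeq (fun _ _ => t) z (n + 1) = _
    rw [tnestSeq, tnest, nest, ← gridPartition_boxes_succ, hU]
    change (nestMeas t z (n + 1)).restrict _ + _ = _
    rw [Measure.restrict_eq_zero.2 h0, zero_add]
    refine Finset.sum_congr rfl fun J _ => ?_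
    rw [vertexMeasure, map_finsetSum_smul _ _ _ (measurable_boxMap J)]
    simp only [map_boxMap_unifBox]
    rfl

theorem nestMeas_succ (z : ℕ → Finset (Fin r) → ℝ) (n : ℕ) : nestMeas t z (n + 1) =
    ∑ J ∈ (gridPartition r t n).boxes, nestMeas t z n J • nestInBox t (z n) J :=
  (nestMeas_succ_and_compl t z n).1

theorem nestMeas_compl_unitBox (z : ℕ → Finset (Fin r) → ℝ) (n : ℕ) :
    nestMeas t z n (unitBox r : Set (Fin r → ℝ))ᶜ = 0 := by
  cases n with
  | zero =>
    change unifBox (unitBox r) _ = 0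
    exact (prob_compl_eq_zero_iff (unitBox r).measurableSet_coe).2 (unifBox_apply_self _)
  | succ n => exact (nestMeas_succ_and_compl t z n).2

instance isFiniteMeasure_nestInBox (z : Finset (Fin r) → ℝ) (J : Box (Fin r)) :
    IsFiniteMeasure (nestInBox t z J) := by
  refine ⟨?_⟩
  rw [nestInBox, Measure.finsetSum_apply]
  refine ENNReal.sum_lt_top.2 fun μ _ => ?_
  simp

instance isFiniteMeasure_nestMeas (z : ℕ → Finset (Fin r) → ℝ) (n : ℕ) :
    IsFiniteMeasure (nestMeas t z n) := by
  induction n with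
  | zero => exact inferInstanceAs (IsFiniteMeasure (unifBox (unitBox r)))
  | succ n ih =>
    refine ⟨?_⟩
    rw [nestMeas_succ, Measure.finsetSum_apply]
    refine ENNReal.sum_lt_top.2 fun J _ => ?_
    exact ENNReal.mul_lt_top (measure_lt_top _ _) (measure_lt_top _ _)

theorem nestMeas_restrict_box (z : ℕ → Finset (Fin r) → ℝ) (n : ℕ) {K : Box (Fin r)}
    (hK : K ∈ gridPartition r t n) :
    (nestMeas t z n).restrict K = nestMeas t z n K • unifBox K := by
  classical
  suffices h : ∃ w : ℝ≥0∞, (nestMeas t z n).restrict K = w • unifBox K by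
    obtain ⟨w, hw⟩ := h
    have h1 := congrArg (fun μ : Measure (Fin r → ℝ) => μ Set.univ) hw
    simp only [Measure.restrict_apply_univ, Measure.smul_apply, measure_univ, smul_eq_mul,
      mul_one] at h1
    rw [hw, h1]
  cases n with
  | zero =>
    simp only [gridPartition, Prepartition.mem_top] at hK
    subst hK
    exact ⟨1, by rw [one_smul]; exact unifBox_restrict_self _⟩
  | succ n =>
    have hcell : ∀ J ∈ gridPartition r t n, ∀ μ,
        (unifBox (vertexSubBox t J μ)).restrict K =
          (if vertexSubBox t J μ = K then (1 : ℝ≥0∞) else 0) • unifBox K := by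
      intro J hJ μ
      split_ifs with h
      · rw [h, unifBox_restrict_self, one_smul]
      · rw [zero_smul]
        refine unifBox_restrict_of_disjoint ?_ K.measurableSet_coe
        exact (gridPartition r t (n + 1)).disjoint_coe_of_mem
          ((mem_gridPartition_succ t).2 ⟨J, hJ, μ, rfl⟩) hK h
    rw [nestMeas_succ, restrict_finsetSum_smul]
    simp only [nestInBox, restrict_finsetSum_smul]
    refine ⟨∑ J ∈ (gridPartition r t n).boxes, nestMeas t z n J * ∑ μ,
      ENNReal.ofReal (projTimesUnif (fun _ => t) (tailVertex J) (z n) μ) *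
        (if vertexSubBox t J μ = K then 1 else 0), ?_⟩
    rw [Finset.sum_smul]
    refine Finset.sum_congr rfl fun J hJ => ?_
    rw [← smul_smul, Finset.sum_smul]
    congr 1
    refine Finset.sum_congr rfl fun μ _ => ?_
    rw [hcell J hJ μ, smul_smul]

theorem nestMeas_eq_sum (z : ℕ → Finset (Fin r) → ℝ) (n : ℕ) : nestMeas t z n =
    ∑ J ∈ (gridPartition r t n).boxes, nestMeas t z n J • unifBox J := by
  have hU : (⋃ J ∈ (gridPartition r t n).boxes, (J : Set (Fin r → ℝ))) = unitBox r :=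
    (gridPartition_isPartition t n).iUnion_eq
  have h1 : (nestMeas t z n).restrict (unitBox r : Set (Fin r → ℝ)) = nestMeas t z n :=
    Measure.restrict_eq_self_of_ae_mem (nestMeas_compl_unitBox t z n)
  conv_lhs => rw [← h1, ← hU]
  rw [Measure.restrict_biUnion_finset (gridPartition r t n).pairwiseDisjoint
    fun J => J.measurableSet_coe, Measure.sum_fintype, Finset.univ_eq_attach,
    Finset.sum_attach _ fun J : Box (Fin r) => (nestMeas t z n).restrict (J : Set (Fin r → ℝ))]
  exact Finset.sum_congr rfl fun J hJ => nestMeas_restrict_box t z n hJ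

theorem nestMeas_eq_boxMeasure (z : ℕ → Finset (Fin r) → ℝ) (n : ℕ) : nestMeas t z n =
    boxMeasure (gridPartition r t n) fun J => (nestMeas t z n J).toNNReal := by
  conv_lhs => rw [nestMeas_eq_sum]
  refine Finset.sum_congr rfl fun J _ => ?_
  rw [ENNReal.coe_toNNReal (measure_ne_top _ _)]

theorem nestMeas_real_pi (z : ℕ → Finset (Fin r) → ℝ) (n : ℕ) {A : Fin r → Set ℝ}
    (hA : ∀ i, MeasurableSet (A i)) :
    (nestMeas t z n).real (Set.univ.pi A) = ∑ J ∈ (gridPartition r t n).boxes,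
      (nestMeas t z n).real J * ∏ i, cellProb (J.lower i) (J.upper i) (A i) := by
  conv_lhs => rw [nestMeas_eq_sum]
  rw [measureReal_def, Measure.finsetSum_apply, ENNReal.toReal_sum]
  · refine Finset.sum_congr rfl fun J _ => ?_
    rw [Measure.smul_apply, smul_eq_mul, ENNReal.toReal_mul, ← measureReal_def, ← measureReal_def,
      unifBox_real_pi J hA]
  · exact fun J _ => ENNReal.mul_ne_top (measure_ne_top _ _) (measure_ne_top _ _)

/-- The masses of product sets after a nesting step: in a box `J`, the coordinates in `tailVertex J`
keep their uniform distribution, and the others move according to a random vertex with law `z n`. -/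
theorem nestMeas_succ_real_pi {z : ℕ → Finset (Fin r) → ℝ} {n : ℕ} (h0 : ∀ ν, 0 ≤ z n ν)
    {A : Fin r → Set ℝ} (hA : ∀ i, MeasurableSet (A i)) :
    (nestMeas t z (n + 1)).real (Set.univ.pi A) = ∑ J ∈ (gridPartition r t n).boxes,
      (nestMeas t z n).real J * ∑ ν, z n ν * ∏ i,
        (if i ∈ tailVertex J then cellProb (J.lower i) (J.upper i) (A i)
          else if i ∈ ν then cellProb (splitPoint t J i) (J.upper i) (A i)
            else cellProb (J.lower i) (splitPoint t J i) (A i)) := by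
  rw [nestMeas_succ, measureReal_def, Measure.finsetSum_apply, ENNReal.toReal_sum]
  · refine Finset.sum_congr rfl fun J _ => ?_
    rw [Measure.smul_apply, smul_eq_mul, ENNReal.toReal_mul, ← measureReal_def]
    congr 1
    rw [nestInBox, Measure.finsetSum_apply, ENNReal.toReal_sum]
    · have key := sum_projTimesUnif_mul_prod t (tailVertex J) (z n)
        (fun i => cellProb (splitPoint t J i) (J.upper i) (A i))
        (fun i => cellProb (J.lower i) (splitPoint t J i) (A i))
      simp only [splitPoint, cellProb_average t.2.1 t.2.2 (J.lower_lt_upper _) (hA _)] at key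
      refine Eq.trans (Finset.sum_congr rfl fun ν _ => ?_) key
      rw [Measure.smul_apply, smul_eq_mul, ENNReal.toReal_mul,
        ENNReal.toReal_ofReal (projTimesUnif_nonneg t _ h0 ν), ← measureReal_def,
        unifBox_real_pi _ hA]
      congr 1
      refine Finset.prod_congr rfl fun i _ => ?_
      rw [vertexSubBox_lower, vertexSubBox_upper]
      split_ifs <;> rfl
    · exact fun μ _ => ENNReal.mul_ne_top ENNReal.ofReal_ne_top (measure_ne_top _ _)
  · exact fun J _ => ENNReal.mul_ne_top (measure_ne_top _ _) (measure_ne_top _ _)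

/-- A nesting step does not change the mass of a product set each of whose factors contains the
leftmost cell `(0, t^n]` or misses it, as the mass is only moved within those cells. -/
theorem nestMeas_succ_real_pi_of_trivial_on_cell {z : ℕ → Finset (Fin r) → ℝ} {n : ℕ}
    (h0 : ∀ ν, 0 ≤ z n ν) (h1 : ∑ ν, z n ν = 1) {A : Fin r → Set ℝ}
    (hA : ∀ i, MeasurableSet (A i))
    (hcase : ∀ i, volume (A i ∩ Set.Ioc 0 ((t : ℝ) ^ n)) = 0 ∨ Set.Ioc 0 ((t : ℝ) ^ n) ⊆ A i) :
    (nestMeas t z (n + 1)).real (Set.univ.pi A) = (nestMeas t z n).real (Set.univ.pi A) := by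
  rw [nestMeas_succ_real_pi t h0 hA, nestMeas_real_pi t z n hA]
  refine Finset.sum_congr rfl fun J hJ => ?_
  congr 1
  have h : ∀ i (ν : Finset (Fin r)), (if i ∈ tailVertex J then cellProb (J.lower i) (J.upper i) (A i)
      else if i ∈ ν then cellProb (splitPoint t J i) (J.upper i) (A i)
        else cellProb (J.lower i) (splitPoint t J i) (A i)) =
      cellProb (J.lower i) (J.upper i) (A i) := by
    intro i ν
    by_cases hi : i ∈ tailVertex J
    · rw [if_pos hi]
    · rw [if_neg hi]
      have hl := lower_lt_splitPoint t J i
      have hu := splitPoint_lt_upper t J i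
      obtain ⟨h2, h3⟩ : J.lower i = 0 ∧ J.upper i = (t : ℝ) ^ n := by
        rcases gridPartition_cases t hJ i with h | h
        exacts [h.2, absurd h.1 hi]
      have hI : Set.Ioc 0 ((t : ℝ) ^ n) = Set.Ioc (J.lower i) (J.upper i) := by rw [h2, h3]
      have hc := hcase i
      rw [hI] at hc
      have s1 : Set.Ioc (J.lower i) (splitPoint t J i) ⊆ Set.Ioc (J.lower i) (J.upper i) :=
        Set.Ioc_subset_Ioc_right hu.le
      have s2 : Set.Ioc (splitPoint t J i) (J.upper i) ⊆ Set.Ioc (J.lower i) (J.upper i) :=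
        Set.Ioc_subset_Ioc_left hl.le
      rcases hc with h | h
      · rw [cellProb_of_null h, cellProb_of_null (measure_mono_null
          (Set.inter_subset_inter_right _ s1) h), cellProb_of_null (measure_mono_null
          (Set.inter_subset_inter_right _ s2) h), ite_self]
      · rw [cellProb_of_subset (J.lower_lt_upper i) h, cellProb_of_subset hl (s1.trans h),
          cellProb_of_subset hu (s2.trans h), ite_self]
  simp_rw [h]
  rw [← Finset.sum_mul, h1, one_mul]

theorem isProbabilityMeasure_nestMeas {z : ℕ → Finset (Fin r) → ℝ} (h0 : ∀ n ν, 0 ≤ z n ν)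
    (h1 : ∀ n, ∑ ν, z n ν = 1) (n : ℕ) : IsProbabilityMeasure (nestMeas t z n) := by
  suffices h : (nestMeas t z n).real Set.univ = 1 by
    exact ⟨(ENNReal.toReal_eq_one_iff _).1 h⟩
  induction n with
  | zero =>
    change (unifBox (unitBox r)).real Set.univ = 1
    exact probReal_univ
  | succ n ih =>
    have h := nestMeas_succ_real_pi_of_trivial_on_cell t (h0 n) (h1 n)
      (A := fun _ => Set.univ) (fun _ => MeasurableSet.univ) fun _ => Or.inr (Set.subset_univ _)
    rw [Set.pi_univ] at h
    rw [h, ih]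

/-- The iterated tail nestings of copulas of order `k` are uniform on the faces of dimension at
most `k`. -/
theorem nestMeas_real_pi_of_card_le {k : ℕ} {z : ℕ → Finset (Fin r) → ℝ} (h0 : ∀ n ν, 0 ≤ z n ν)
    (hz : ∀ n (G : Finset (Fin r)), G.card ≤ k → avoidMass (z n) G = (t : ℝ) ^ G.card)
    {F : Finset (Fin r)} (hF : F.card ≤ k) {A : Fin r → Set ℝ} (hA : ∀ i, MeasurableSet (A i))
    (hAF : ∀ i ∉ F, A i = Set.univ) (n : ℕ) :
    (nestMeas t z n).real (Set.univ.pi A) = ∏ i, cellProb 0 1 (A i) := by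
  induction n with
  | zero => exact unifBox_real_pi _ hA
  | succ n ih =>
    rw [← ih, nestMeas_succ_real_pi t (h0 n) hA, nestMeas_real_pi t z n hA]
    refine Finset.sum_congr rfl fun J hJ => ?_
    congr 1
    simp_rw [fun (ν : Finset (Fin r)) i =>
      show (if i ∈ tailVertex J then cellProb (J.lower i) (J.upper i) (A i)
        else if i ∈ ν then cellProb (splitPoint t J i) (J.upper i) (A i)
          else cellProb (J.lower i) (splitPoint t J i) (A i)) =
        if i ∈ ν then (if i ∈ tailVertex J then cellProb (J.lower i) (J.upper i) (A i)
          else cellProb (splitPoint t J i) (J.upper i) (A i))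
        else (if i ∈ tailVertex J then cellProb (J.lower i) (J.upper i) (A i)
          else cellProb (J.lower i) (splitPoint t J i) (A i)) by split_ifs <;> rfl]
    rw [sum_mul_prod_of_avoidMass (hz n) hF]
    · refine Finset.prod_congr rfl fun i _ => ?_
      split_ifs
      · ring
      · exact cellProb_average t.2.1 t.2.2 (J.lower_lt_upper i) (hA i)
    · intro i hi
      rw [hAF i hi, cellProb_of_subset (lower_lt_splitPoint t J i) (Set.subset_univ _),
        cellProb_of_subset (splitPoint_lt_upper t J i) (Set.subset_univ _)]

/-! ### Mass near the front faces -/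

/-- The set of points whose coordinates in `F` lie in `[0, s]`. -/
def cornerSet (F : Finset (Fin r)) (s : ℝ) : Set (Fin r → ℝ) :=
  Set.univ.pi fun i => if i ∈ F then Set.Icc 0 s else Set.univ

/-- The probability generating function of the number of nonzero coordinates in `F` of a random
vertex. -/
def tailPoly (z : Finset (Fin r) → ℝ) (F : Finset (Fin r)) (l : ℝ) : ℝ :=
  ∑ ν, z ν * l ^ (ν ∩ F).card

theorem tailPoly_zero (z : Finset (Fin r) → ℝ) (F : Finset (Fin r)) :
    tailPoly z F 0 = avoidMass z F := by
  rw [tailPoly, avoidMass, Finset.sum_filter]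
  refine Finset.sum_congr rfl fun ν _ => ?_
  split_ifs with h
  · rw [Finset.disjoint_iff_inter_eq_empty.1 h]
    simp
  · rw [zero_pow, mul_zero]
    rwa [Ne, Finset.card_eq_zero, ← Finset.disjoint_iff_inter_eq_empty]

theorem measurableSet_cornerFactor (F : Finset (Fin r)) (s : ℝ) (i : Fin r) :
    MeasurableSet (if i ∈ F then Set.Icc 0 s else Set.univ : Set ℝ) := by
  split_ifs
  exacts [measurableSet_Icc, MeasurableSet.univ]

/-- The mass of `[0, s]^F` for `s` between two consecutive scales. -/
theorem nestMeas_succ_real_cornerSet {z : ℕ → Finset (Fin r) → ℝ} {n : ℕ} (h0 : ∀ ν, 0 ≤ z n ν)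
    (F : Finset (Fin r)) {l : ℝ} (hl0 : 0 ≤ l) (hl1 : l ≤ 1) :
    (nestMeas t z (n + 1)).real (cornerSet F ((t : ℝ) ^ n * (t + (1 - t) * l))) =
      (nestMeas t z n).real (cornerSet F ((t : ℝ) ^ n)) * tailPoly (z n) F l := by
  have ht0 : (0 : ℝ) < t := t.2.1
  have ht1 : (t : ℝ) < 1 := t.2.2
  have hp : (0 : ℝ) < (t : ℝ) ^ n := pow_pos ht0 n
  set s : ℝ := (t : ℝ) ^ n * (t + (1 - t) * l) with hs
  have hs1 : s ≤ (t : ℝ) ^ n := by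
    rw [hs]
    exact mul_le_of_le_one_right hp.le (by nlinarith)
  have hs0 : (t : ℝ) ^ n * t ≤ s := by
    rw [hs]
    exact mul_le_mul_of_nonneg_left (by nlinarith) hp.le
  rw [cornerSet, cornerSet, nestMeas_succ_real_pi t h0 (measurableSet_cornerFactor F s),
    nestMeas_real_pi t z n (measurableSet_cornerFactor F _), Finset.sum_mul]
  refine Finset.sum_congr rfl fun J hJ => ?_
  rw [mul_assoc]
  congr 1
  by_cases hd : Disjoint (tailVertex J) F
  · have hcell : ∀ i ∈ F, i ∉ tailVertex J ∧ J.lower i = 0 ∧ J.upper i = (t : ℝ) ^ n := by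
      intro i hi
      rcases gridPartition_cases t hJ i with h | h
      exacts [h, absurd hi (Finset.disjoint_left.1 hd h.1)]
    rw [Finset.prod_eq_one, one_mul, tailPoly]
    · refine Finset.sum_congr rfl fun ν _ => ?_
      congr 1
      rw [← Finset.prod_const, ← Finset.prod_subset (Finset.subset_univ (ν ∩ F))]
      · refine Finset.prod_congr rfl fun i hi => ?_
        obtain ⟨hν, hF⟩ := Finset.mem_inter.1 hi
        obtain ⟨hT, e1, e2⟩ := hcell i hF
        rw [if_neg hT, if_pos hν, if_pos hF, splitPoint, e1, e2, cellProb,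
          show Set.Icc 0 s ∩ Set.Ioc (0 + t * ((t : ℝ) ^ n - 0)) ((t : ℝ) ^ n) =
            Set.Ioc (t * (t : ℝ) ^ n) s from ?_, Real.volume_real_Ioc_of_le (by linarith), hs]
        · have : (1 - (t : ℝ)) ≠ 0 := (sub_pos.2 ht1).ne'
          have e : (t : ℝ) ^ n - (0 + t * ((t : ℝ) ^ n - 0)) = (1 - t) * (t : ℝ) ^ n := by ring
          rw [e]
          field_simp
          ring
        · ext x
          simp only [Set.mem_inter_iff, Set.mem_Icc, Set.mem_Ioc, sub_zero, zero_add]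
          constructor
          · exact fun h => ⟨h.2.1, h.1.2⟩
          · exact fun h => ⟨⟨(mul_pos ht0 hp).le.trans h.1.le, h.2⟩, h.1, h.2.trans hs1⟩
      · intro i _ hi
        by_cases hF : i ∈ F
        · have hν : i ∉ ν := fun h => hi (Finset.mem_inter.2 ⟨h, hF⟩)
          obtain ⟨hT, e1, e2⟩ := hcell i hF
          rw [if_neg hT, if_neg hν, if_pos hF]
          refine cellProb_of_subset (lower_lt_splitPoint t J i) ?_
          rw [splitPoint, e1, e2]
          intro x hx
          simp only [Set.mem_Ioc, sub_zero, zero_add] at hx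
          exact ⟨hx.1.le, by linarith [hx.2]⟩
        · rw [if_neg hF, cellProb_of_subset (J.lower_lt_upper i) (Set.subset_univ _),
            cellProb_of_subset (lower_lt_splitPoint t J i) (Set.subset_univ _),
            cellProb_of_subset (splitPoint_lt_upper t J i) (Set.subset_univ _), ite_self, ite_self]
    · intro i _
      refine cellProb_of_subset (J.lower_lt_upper i) ?_
      split_ifs with hF
      · rw [(hcell i hF).2.1, (hcell i hF).2.2]
        exact Set.Ioc_subset_Icc_self
      · exact Set.subset_univ _
  · -- A box to the right of the leftmost cell in some coordinate of `F` misses both sets.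
    obtain ⟨i, hT, hF⟩ := Finset.not_disjoint_iff.1 hd
    have hlow : (t : ℝ) ^ n ≤ J.lower i := by
      rcases gridPartition_cases t hJ i with h | h
      exacts [absurd hT h.1, h.2]
    have hz : ∀ s' ≤ (t : ℝ) ^ n, cellProb (J.lower i) (J.upper i) (Set.Icc 0 s') = 0 := by
      intro s' hs'
      refine cellProb_of_null ?_
      rw [Set.disjoint_iff_inter_eq_empty.1, measure_empty]
      rw [Set.disjoint_left]
      intro x hx hx'
      linarith [hx.2, hx'.1]
    rw [Finset.prod_eq_zero (Finset.mem_univ i), zero_mul]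
    · refine Finset.sum_eq_zero fun ν _ => ?_
      rw [Finset.prod_eq_zero (Finset.mem_univ i), mul_zero]
      rw [if_pos hT, if_pos hF, hz _ hs1]
    · rw [if_pos hF, hz _ le_rfl]

theorem nestMeas_real_cornerSet_pow {z : ℕ → Finset (Fin r) → ℝ} (h0 : ∀ n ν, 0 ≤ z n ν)
    (F : Finset (Fin r)) (n : ℕ) :
    (nestMeas t z n).real (cornerSet F ((t : ℝ) ^ n)) = ∏ j ∈ Finset.range n, avoidMass (z j) F := by
  induction n with
  | zero =>
    rw [cornerSet, Finset.prod_range_zero]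
    change (unifBox (unitBox r)).real _ = 1
    rw [unifBox_real_pi _ (measurableSet_cornerFactor F _)]
    refine Finset.prod_eq_one fun i _ => cellProb_of_subset ((unitBox r).lower_lt_upper i) ?_
    split_ifs
    · simpa [unitBox] using Set.Ioc_subset_Icc_self
    · exact Set.subset_univ _
  | succ n ih =>
    have h := nestMeas_succ_real_cornerSet t (h0 n) F le_rfl zero_le_one
    rw [mul_zero, add_zero, ← pow_succ, ih, tailPoly_zero] at h
    rw [h, Finset.prod_range_succ]

theorem nestMeas_real_cornerSet_of_le {z : ℕ → Finset (Fin r) → ℝ} (h0 : ∀ n ν, 0 ≤ z n ν)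
    (h1 : ∀ n, ∑ ν, z n ν = 1) (F : Finset (Fin r)) {n m : ℕ} (hnm : n ≤ m) {s : ℝ}
    (hs : (t : ℝ) ^ n ≤ s) :
    (nestMeas t z m).real (cornerSet F s) = (nestMeas t z n).real (cornerSet F s) := by
  induction m, hnm using Nat.le_induction with
  | base => rfl
  | succ m hm ih =>
    rw [← ih]
    refine nestMeas_succ_real_pi_of_trivial_on_cell t (h0 m) (h1 m)
      (measurableSet_cornerFactor F s) fun i => Or.inr ?_
    split_ifs
    · exact fun x hx => ⟨hx.1.le, hx.2.trans ((pow_le_pow_of_le_one t.2.1.le t.2.2.le hm).trans hs)⟩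
    · exact Set.subset_univ _

/-! ### The limit measure -/

/-- The points all of whose coordinates exceed `t^n`. -/
def innerSet (r : ℕ) (t : Set.Ioo (0 : ℝ) 1) (n : ℕ) : Set (Fin r → ℝ) :=
  Set.univ.pi fun _ => Set.Ioi ((t : ℝ) ^ n)

theorem measurableSet_innerSet (n : ℕ) : MeasurableSet (innerSet r t n) :=
  MeasurableSet.univ_pi fun _ => measurableSet_Ioi

theorem innerSet_mono : Monotone (innerSet r t) := fun _ _ h =>
  Set.pi_mono fun _ _ => Set.Ioi_subset_Ioi (pow_le_pow_of_le_one t.2.1.le t.2.2.le h)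

theorem nestMeas_succ_restrict_innerSet {z : ℕ → Finset (Fin r) → ℝ} (h0 : ∀ n ν, 0 ≤ z n ν)
    (h1 : ∀ n, ∑ ν, z n ν = 1) (n : ℕ) :
    (nestMeas t z (n + 1)).restrict (innerSet r t n) =
      (nestMeas t z n).restrict (innerSet r t n) := by
  refine measure_ext_of_real_pi fun A hA => ?_
  rw [measureReal_restrict_apply (MeasurableSet.univ_pi hA),
    measureReal_restrict_apply (MeasurableSet.univ_pi hA), innerSet, ← Set.pi_inter_distrib]
  refine nestMeas_succ_real_pi_of_trivial_on_cell t (h0 n) (h1 n)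
    (fun i => (hA i).inter measurableSet_Ioi) fun i => Or.inl ?_
  rw [Set.disjoint_iff_inter_eq_empty.1, measure_empty]
  rw [Set.disjoint_left]
  exact fun x hx hx' => not_lt.2 hx'.2 hx.2

theorem nestMeas_apply_of_subset_innerSet {z : ℕ → Finset (Fin r) → ℝ} (h0 : ∀ n ν, 0 ≤ z n ν)
    (h1 : ∀ n, ∑ ν, z n ν = 1) {n m : ℕ} (hnm : n ≤ m) {S : Set (Fin r → ℝ)}
    (hS : MeasurableSet S) (hSn : S ⊆ innerSet r t n) : nestMeas t z m S = nestMeas t z n S := by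
  induction m, hnm using Nat.le_induction with
  | base => rfl
  | succ m hm ih =>
    have hSm : S ∩ innerSet r t m = S := Set.inter_eq_left.2 (hSn.trans (innerSet_mono t hm))
    rw [← ih, ← hSm, ← Measure.restrict_apply hS, nestMeas_succ_restrict_innerSet t h0 h1,
      Measure.restrict_apply hS]

/-- The limit of the iterated tail nestings: on the points with all coordinates greater than `t^n`
it coincides with the `n`-th nesting, and it gives no mass to the points with a coordinate `≤ 0`. -/
def limitMeas (z : ℕ → Finset (Fin r) → ℝ) : Measure (Fin r → ℝ) :=
  Measure.sum fun n => (nestMeas t z n).restrict (disjointed (innerSet r t) n)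

theorem limitMeas_apply_of_subset_innerSet {z : ℕ → Finset (Fin r) → ℝ} (h0 : ∀ n ν, 0 ≤ z n ν)
    (h1 : ∀ n, ∑ ν, z n ν = 1) {n : ℕ} {S : Set (Fin r → ℝ)}
    (hS : MeasurableSet S) (hSn : S ⊆ innerSet r t n) : limitMeas t z S = nestMeas t z n S := by
  have hmeas : ∀ m, MeasurableSet (disjointed (innerSet r t) m) :=
    fun m => MeasurableSet.disjointed (measurableSet_innerSet t) m
  have hterm : ∀ m, nestMeas t z m (S ∩ disjointed (innerSet r t) m) =
      nestMeas t z n (S ∩ disjointed (innerSet r t) m) := by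
    intro m
    rcases le_or_gt m n with hmn | hmn
    · exact (nestMeas_apply_of_subset_innerSet t h0 h1 hmn (hS.inter (hmeas m))
        (Set.inter_subset_right.trans (disjointed_subset _ _))).symm
    · exact nestMeas_apply_of_subset_innerSet t h0 h1 hmn.le (hS.inter (hmeas m))
        (Set.inter_subset_left.trans hSn)
  rw [limitMeas, Measure.sum_apply _ hS]
  simp_rw [Measure.restrict_apply hS, hterm]
  rw [← measure_iUnion, ← Set.inter_iUnion, iUnion_disjointed, Set.inter_eq_left.2]
  · exact hSn.trans (Set.subset_iUnion _ n)
  · exact fun i j hij => (disjoint_disjointed _ hij).mono Set.inter_subset_right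
      Set.inter_subset_right
  · exact fun m => hS.inter (hmeas m)

theorem limitMeas_restrict_innerSet {z : ℕ → Finset (Fin r) → ℝ} (h0 : ∀ n ν, 0 ≤ z n ν)
    (h1 : ∀ n, ∑ ν, z n ν = 1) (n : ℕ) :
    (limitMeas t z).restrict (innerSet r t n) = (nestMeas t z n).restrict (innerSet r t n) := by
  ext S hS
  rw [Measure.restrict_apply hS, Measure.restrict_apply hS,
    limitMeas_apply_of_subset_innerSet t h0 h1 (hS.inter (measurableSet_innerSet t n))
      Set.inter_subset_right]

section Copula

variable {k : ℕ} {z : ℕ → Finset (Fin r) → ℝ}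

theorem sum_eq_one_of_avoidMass
    (hz : ∀ n (G : Finset (Fin r)), G.card ≤ k → avoidMass (z n) G = (t : ℝ) ^ G.card) (n : ℕ) :
    ∑ ν, z n ν = 1 := by
  rw [← avoidMass_empty, hz n ∅ (by simp), Finset.card_empty, pow_zero]

/-- By uniformity of the one-dimensional projections the mass close to the boundary is small. -/
theorem nestMeas_real_compl_innerSet_le (hk : 1 ≤ k) (h0 : ∀ n ν, 0 ≤ z n ν)
    (hz : ∀ n (G : Finset (Fin r)), G.card ≤ k → avoidMass (z n) G = (t : ℝ) ^ G.card) (n : ℕ) :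
    (nestMeas t z n).real (innerSet r t n)ᶜ ≤ r * (t : ℝ) ^ n := by
  have hp : (0 : ℝ) < (t : ℝ) ^ n := pow_pos t.2.1 n
  have hp1 : (t : ℝ) ^ n ≤ 1 := pow_le_one₀ t.2.1.le t.2.2.le
  have hsub : (innerSet r t n)ᶜ ⊆ ⋃ i ∈ (Finset.univ : Finset (Fin r)),
      Set.univ.pi fun j => if j = i then Set.Iic ((t : ℝ) ^ n) else Set.univ := by
    intro w hw
    simp only [innerSet, Set.mem_compl_iff, Set.mem_univ_pi, Set.mem_Ioi, not_forall, not_lt] at hw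
    obtain ⟨i, hi⟩ := hw
    simp only [Set.mem_iUnion, Finset.mem_univ, exists_prop, true_and]
    refine ⟨i, fun j _ => ?_⟩
    by_cases hj : j = i
    · subst hj
      simpa using hi
    · simp [hj]
  refine (measureReal_mono hsub (measure_ne_top _ _)).trans ((measureReal_biUnion_finset_le _ _).trans ?_)
  refine (Finset.sum_le_card_nsmul _ _ ((t : ℝ) ^ n) fun i _ => le_of_eq ?_).trans (by simp)
  rw [nestMeas_real_pi_of_card_le t h0 hz (F := {i}) (by simpa using hk)]
  · rw [Finset.prod_eq_single i]
    · rw [if_pos rfl, cellProb, Set.inter_comm, Set.Ioc_inter_Iic, min_eq_right hp1,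
        Real.volume_real_Ioc_of_le hp.le]
      simp
    · intro j _ hj
      rw [if_neg hj, cellProb_of_subset zero_lt_one (Set.subset_univ _)]
    · simp
  · intro j
    split_ifs
    exacts [measurableSet_Iic, MeasurableSet.univ]
  · intro j hj
    rw [if_neg (by simpa using hj)]

theorem tendsto_mul_pow_zero (C : ℝ) : Tendsto (fun n : ℕ => C * (t : ℝ) ^ n) atTop (𝓝 0) := by
  simpa using (tendsto_pow_atTop_nhds_zero_of_lt_one t.2.1.le t.2.2).const_mul C

theorem isProbabilityMeasure_limitMeas (hk : 1 ≤ k) (h0 : ∀ n ν, 0 ≤ z n ν)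
    (hz : ∀ n (G : Finset (Fin r)), G.card ≤ k → avoidMass (z n) G = (t : ℝ) ^ G.card) :
    IsProbabilityMeasure (limitMeas t z) := by
  have h1 := sum_eq_one_of_avoidMass t hz
  have := isProbabilityMeasure_nestMeas t h0 h1
  have hU : limitMeas t z (⋃ n, innerSet r t n)ᶜ = 0 := by
    have hm : MeasurableSet (⋃ n, innerSet r t n)ᶜ :=
      (MeasurableSet.iUnion (measurableSet_innerSet t)).compl
    rw [limitMeas, Measure.sum_apply _ hm, ENNReal.tsum_eq_zero]
    intro n
    rw [Measure.restrict_apply hm, Set.disjoint_iff_inter_eq_empty.1, measure_empty]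
    rw [Set.disjoint_left]
    exact fun x hx hx' => hx (Set.mem_iUnion.2 ⟨n, disjointed_subset _ _ hx'⟩)
  have hlim : Tendsto (fun n => limitMeas t z (innerSet r t n)) atTop
      (𝓝 (limitMeas t z (⋃ n, innerSet r t n))) :=
    tendsto_measure_iUnion_atTop (innerSet_mono t)
  have hlim' : Tendsto (fun n => limitMeas t z (innerSet r t n)) atTop (𝓝 1) := by
    have hreal : Tendsto (fun n => (nestMeas t z n).real (innerSet r t n)) atTop (𝓝 1) := by
      refine tendsto_of_tendsto_of_tendsto_of_le_of_le (g := fun n => 1 - r * (t : ℝ) ^ n)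
        (h := fun _ => 1) ?_ tendsto_const_nhds (fun n => ?_) fun n => measureReal_le_one
      · simpa using (tendsto_mul_pow_zero t r).const_sub 1
      · have := nestMeas_real_compl_innerSet_le t hk h0 hz n
        rw [probReal_compl_eq_one_sub (measurableSet_innerSet t n)] at this
        change 1 - _ ≤ _
        linarith
    have := ENNReal.tendsto_ofReal hreal
    rw [ENNReal.ofReal_one] at this
    refine this.congr fun n => ?_
    rw [ofReal_measureReal, limitMeas_apply_of_subset_innerSet t h0 h1
      (measurableSet_innerSet t n) subset_rfl]
  refine ⟨?_⟩
  rw [← measure_add_measure_compl (MeasurableSet.iUnion (measurableSet_innerSet t)), hU, add_zero,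
    tendsto_nhds_unique hlim hlim']

theorem limitMeas_real_compl_innerSet_le (hk : 1 ≤ k) (h0 : ∀ n ν, 0 ≤ z n ν)
    (hz : ∀ n (G : Finset (Fin r)), G.card ≤ k → avoidMass (z n) G = (t : ℝ) ^ G.card) (n : ℕ) :
    (limitMeas t z).real (innerSet r t n)ᶜ ≤ r * (t : ℝ) ^ n := by
  have h1 := sum_eq_one_of_avoidMass t hz
  have := isProbabilityMeasure_nestMeas t h0 h1
  have := isProbabilityMeasure_limitMeas t hk h0 hz
  refine le_trans (le_of_eq ?_) (nestMeas_real_compl_innerSet_le t hk h0 hz n)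
  rw [probReal_compl_eq_one_sub (measurableSet_innerSet t n),
    probReal_compl_eq_one_sub (measurableSet_innerSet t n), measureReal_def, measureReal_def,
    limitMeas_apply_of_subset_innerSet t h0 h1 (measurableSet_innerSet t n) subset_rfl]

theorem tendsto_nestMeas_real (hk : 1 ≤ k) (h0 : ∀ n ν, 0 ≤ z n ν)
    (hz : ∀ n (G : Finset (Fin r)), G.card ≤ k → avoidMass (z n) G = (t : ℝ) ^ G.card)
    {S : Set (Fin r → ℝ)} (hS : MeasurableSet S) :
    Tendsto (fun n => (nestMeas t z n).real S) atTop (𝓝 ((limitMeas t z).real S)) := by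
  have h1 := sum_eq_one_of_avoidMass t hz
  have := isProbabilityMeasure_limitMeas t hk h0 hz
  rw [tendsto_iff_norm_sub_tendsto_zero]
  refine squeeze_zero (fun _ => norm_nonneg _) (fun n => ?_) (tendsto_mul_pow_zero t r)
  have e1 := measureReal_inter_add_sdiff (μ := nestMeas t z n) (s := S)
    (measurableSet_innerSet t n)
  have e2 := measureReal_inter_add_sdiff (μ := limitMeas t z) (s := S)
    (measurableSet_innerSet t n)
  have e3 : (limitMeas t z).real (S ∩ innerSet r t n) =
      (nestMeas t z n).real (S ∩ innerSet r t n) := by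
    rw [measureReal_def, measureReal_def, limitMeas_apply_of_subset_innerSet t h0 h1
      (hS.inter (measurableSet_innerSet t n)) Set.inter_subset_right]
  have hsub : S \ innerSet r t n ⊆ (innerSet r t n)ᶜ := fun x hx => hx.2
  have b1 := (measureReal_mono (μ := nestMeas t z n) hsub).trans
    (nestMeas_real_compl_innerSet_le t hk h0 hz n)
  have b2 := (measureReal_mono (μ := limitMeas t z) hsub).trans
    (limitMeas_real_compl_innerSet_le t hk h0 hz n)
  have p1 : 0 ≤ (nestMeas t z n).real (S \ innerSet r t n) := measureReal_nonneg
  have p2 : 0 ≤ (limitMeas t z).real (S \ innerSet r t n) := measureReal_nonneg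
  rw [Real.norm_eq_abs, abs_le]
  constructor <;> linarith

theorem limitMeas_real_eq_of_eventually (hk : 1 ≤ k) (h0 : ∀ n ν, 0 ≤ z n ν)
    (hz : ∀ n (G : Finset (Fin r)), G.card ≤ k → avoidMass (z n) G = (t : ℝ) ^ G.card)
    {S : Set (Fin r → ℝ)} (hS : MeasurableSet S) {v : ℝ} (n : ℕ)
    (hv : ∀ m ≥ n, (nestMeas t z m).real S = v) : (limitMeas t z).real S = v := by
  refine tendsto_nhds_unique (tendsto_nestMeas_real t hk h0 hz hS) ?_
  exact tendsto_const_nhds.congr' (eventually_atTop.2 ⟨n, fun m hm => (hv m hm).symm⟩)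

theorem tendsto_integral_nestMeas (hk : 1 ≤ k) (h0 : ∀ n ν, 0 ≤ z n ν)
    (hz : ∀ n (G : Finset (Fin r)), G.card ≤ k → avoidMass (z n) G = (t : ℝ) ^ G.card)
    (f : BoundedContinuousFunction (Fin r → ℝ) ℝ) :
    Tendsto (fun n => ∫ x, f x ∂(nestMeas t z n)) atTop (𝓝 (∫ x, f x ∂(limitMeas t z))) := by
  have h1 := sum_eq_one_of_avoidMass t hz
  have := isProbabilityMeasure_limitMeas t hk h0 hz
  rw [tendsto_iff_norm_sub_tendsto_zero]
  refine squeeze_zero (fun _ => norm_nonneg _) (fun n => ?_)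
    (tendsto_mul_pow_zero t (2 * ‖f‖ * r))
  have e1 := integral_add_compl (measurableSet_innerSet (r := r) t n)
    (f.integrable (nestMeas t z n))
  have e2 := integral_add_compl (measurableSet_innerSet (r := r) t n)
    (f.integrable (limitMeas t z))
  rw [limitMeas_restrict_innerSet t h0 h1] at e2
  have b1 : ‖∫ x in (innerSet r t n)ᶜ, f x ∂(nestMeas t z n)‖ ≤ ‖f‖ * (r * (t : ℝ) ^ n) :=
    (norm_setIntegral_le_of_norm_le_const (measure_lt_top _ _) fun x _ => f.norm_coe_le_norm x).trans
      (mul_le_mul_of_nonneg_left (nestMeas_real_compl_innerSet_le t hk h0 hz n) (norm_nonneg f))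
  have b2 : ‖∫ x in (innerSet r t n)ᶜ, f x ∂(limitMeas t z)‖ ≤ ‖f‖ * (r * (t : ℝ) ^ n) :=
    (norm_setIntegral_le_of_norm_le_const (measure_lt_top _ _) fun x _ => f.norm_coe_le_norm x).trans
      (mul_le_mul_of_nonneg_left (limitMeas_real_compl_innerSet_le t hk h0 hz n) (norm_nonneg f))
  rw [← e1, ← e2, add_sub_add_left_eq_sub]
  refine (norm_sub_le _ _).trans ?_
  linarith

theorem isTailNesting_limitMeas (hk : 1 ≤ k) (h0 : ∀ n ν, 0 ≤ z n ν)
    (hz : ∀ n (G : Finset (Fin r)), G.card ≤ k → avoidMass (z n) G = (t : ℝ) ^ G.card) :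
    IsTailNesting (fun _ _ => t) z (limitMeas t z) := by
  have h1 := sum_eq_one_of_avoidMass t hz
  have := isProbabilityMeasure_limitMeas t hk h0 hz
  refine ⟨this, fun f => ?_, fun n J hJ => ?_⟩
  · exact (tendsto_add_atTop_iff_nat (f := fun n => ∫ x, f x ∂(nestMeas t z n)) 1).2
      (tendsto_integral_nestMeas t hk h0 hz f)
  · rw [← gridPartition_boxes_succ] at hJ
    change limitMeas t z (Box.Icc J) = nestMeas t z (n + 1) (Box.Icc J)
    rw [← ENNReal.toReal_eq_toReal_iff' (measure_ne_top _ _) (measure_ne_top _ _),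
      ← measureReal_def, ← measureReal_def, Box.Icc_eq_pi]
    refine limitMeas_real_eq_of_eventually t hk h0 hz
      (MeasurableSet.univ_pi fun i => measurableSet_Icc) (n + 1) fun m hm => ?_
    induction m, hm using Nat.le_induction with
    | base => rfl
    | succ m hm ih =>
      rw [← ih]
      refine nestMeas_succ_real_pi_of_trivial_on_cell t (h0 m) (h1 m)
        (fun i => measurableSet_Icc) fun i => ?_
      have hp : (t : ℝ) ^ m ≤ (t : ℝ) ^ (n + 1) := pow_le_pow_of_le_one t.2.1.le t.2.2.le hm
      rcases gridPartition_cases t hJ i with ⟨-, h2, h3⟩ | ⟨-, h2⟩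
      · right
        rw [h2, h3]
        exact fun x hx => ⟨hx.1.le, hx.2.trans hp⟩
      · left
        -- A closed edge to the right of the leftmost cell meets it in the endpoint `t^m` at most.
        refine measure_mono_null (t := {(t : ℝ) ^ m}) (fun x hx => ?_) Real.volume_singleton
        exact le_antisymm hx.2.2 ((hp.trans h2).trans hx.1.1)

theorem isCopulaOfOrder_limitMeas (hk : 1 ≤ k) (h0 : ∀ n ν, 0 ≤ z n ν)
    (hz : ∀ n (G : Finset (Fin r)), G.card ≤ k → avoidMass (z n) G = (t : ℝ) ^ G.card) :
    IsCopulaOfOrder k (limitMeas t z) := by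
  have h1 := sum_eq_one_of_avoidMass t hz
  have := isProbabilityMeasure_nestMeas t h0 h1
  have := isProbabilityMeasure_limitMeas t hk h0 hz
  refine ⟨this, ?_, fun F hF => ?_⟩
  · have h : (limitMeas t z).real (unitBox r : Set (Fin r → ℝ)) = 1 :=
      limitMeas_real_eq_of_eventually t hk h0 hz (unitBox r).measurableSet_coe 0 fun m _ => by
        rw [measureReal_def, (prob_compl_eq_zero_iff (unitBox r).measurableSet_coe).1
          (nestMeas_compl_unitBox t z m), ENNReal.toReal_one]
    refine le_antisymm prob_le_one ?_
    rw [← (ENNReal.toReal_eq_one_iff _).1 h]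
    exact measure_mono (unitBox r).coe_subset_Icc
  · have hres : Measurable (F.restrict : (Fin r → ℝ) → F → ℝ) := Finset.measurable_restrict F
    rw [← Set.pi_univ_Icc, volume_pi, Measure.restrict_pi_pi, faceMeasure]
    refine (Measure.pi_eq fun S hS => ?_).symm
    classical
    set A : Fin r → Set ℝ := fun i => if h : i ∈ F then S ⟨i, h⟩ else Set.univ with hA
    have hAm : ∀ i, MeasurableSet (A i) := by
      intro i
      rw [hA]
      by_cases h : i ∈ F
      · simpa [h] using hS ⟨i, h⟩
      · simp [h]
    have hpre : (F.restrict : (Fin r → ℝ) → F → ℝ) ⁻¹' Set.univ.pi S = Set.univ.pi A := by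
      ext w
      simp only [Set.mem_preimage, Set.mem_univ_pi, hA]
      constructor
      · intro h i
        by_cases hi : i ∈ F
        · simpa [hi] using h ⟨i, hi⟩
        · simp [hi]
      · intro h i
        simpa using h i
    have hval := limitMeas_real_eq_of_eventually t hk h0 hz (MeasurableSet.univ_pi hAm) 0
      fun m _ => nestMeas_real_pi_of_card_le t h0 hz hF.le hAm (fun i hi => by simp [hA, hi]) m
    rw [Measure.map_apply hres (MeasurableSet.univ_pi hS), hpre,
      ← ENNReal.toReal_eq_toReal_iff' (measure_ne_top _ _)
        (ENNReal.prod_ne_top fun i _ => measure_ne_top _ _), ← measureReal_def, hval,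
      ENNReal.toReal_prod, ← Finset.prod_subset (Finset.subset_univ F), ← Finset.prod_coe_sort]
    · refine Finset.prod_congr rfl fun i _ => ?_
      rw [hA, Measure.restrict_apply (hS i)]
      simp only [i.2, dite_true, cellProb, sub_zero, div_one, measureReal_def, Pi.zero_apply,
        Pi.one_apply]
      congr 1
      exact measure_congr ((ae_eq_refl _).inter Ioc_ae_eq_Icc)
    · intro i _ hi
      rw [hA]
      simp only [hi, dite_false]
      exact cellProb_of_subset zero_lt_one (Set.subset_univ _)

theorem locallyPiecewiseUniformOn_limitMeas (h0 : ∀ n ν, 0 ≤ z n ν)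
    (h1 : ∀ n, ∑ ν, z n ν = 1) :
    LocallyPiecewiseUniformOn (limitMeas t z) {w | ∀ i, w i ∈ Set.Ioo (0 : ℝ) 1} := by
  intro w hw
  have hlim := tendsto_pow_atTop_nhds_zero_of_lt_one t.2.1.le t.2.2
  obtain ⟨n, hn⟩ : ∃ n : ℕ, ∀ i, (t : ℝ) ^ n < w i :=
    (eventually_all.2 fun i => hlim.eventually_lt_const (hw i).1).exists
  refine ⟨innerSet r t n, mem_nhdsWithin_of_mem_nhds ?_, gridPartition r t n,
    fun J => (nestMeas t z n J).toNNReal, gridPartition_isPartition t n, ?_⟩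
  · exact (isOpen_set_pi Set.finite_univ fun _ _ => isOpen_Ioi).mem_nhds fun i _ => hn i
  · rw [limitMeas_restrict_innerSet t h0 h1, ← nestMeas_eq_boxMeasure]

/-- The mass of `[0, s]^F` under the limit measure, `s = t^n (t + (1 - t) l)`. -/
theorem limitMeas_real_cornerSet (hk : 1 ≤ k) (h0 : ∀ n ν, 0 ≤ z n ν)
    (hz : ∀ n (G : Finset (Fin r)), G.card ≤ k → avoidMass (z n) G = (t : ℝ) ^ G.card)
    (F : Finset (Fin r)) (n : ℕ) {l : ℝ} (hl0 : 0 ≤ l) (hl1 : l ≤ 1) :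
    (limitMeas t z).real (cornerSet F ((t : ℝ) ^ n * (t + (1 - t) * l))) =
      (∏ j ∈ Finset.range n, avoidMass (z j) F) * tailPoly (z n) F l := by
  have h1 := sum_eq_one_of_avoidMass t hz
  refine limitMeas_real_eq_of_eventually t hk h0 hz
    (MeasurableSet.univ_pi (measurableSet_cornerFactor F _)) (n + 1) fun m hm => ?_
  change (nestMeas t z m).real (cornerSet F _) = _
  rw [nestMeas_real_cornerSet_of_le t h0 h1 F hm,
    nestMeas_succ_real_cornerSet t (h0 n) F hl0 hl1, nestMeas_real_cornerSet_pow t h0]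
  rw [pow_succ]
  refine mul_le_mul_of_nonneg_left ?_ (pow_nonneg t.2.1.le n)
  have := mul_nonneg (sub_nonneg.2 t.2.2.le) hl0
  linarith

end Copula

end TailNesting

namespace TailNesting

variable {r : ℕ}

/-! ### Tail degree and tail coefficient -/

/-- A positive finite lower limit of `c([0,s]^ι) / s^b` determines both tail invariants. -/
theorem tailCoef_and_tailDegree_of_liminf {ι : Type*} [Fintype ι] {c : Measure (ι → ℝ)} {a b : ℝ}
    (ha : 0 < a) (hb : 0 ≤ b)
    (h : liminf (fun s : ℝ => c (Set.Icc 0 (fun _ => s)) / ENNReal.ofReal (s ^ b)) (𝓝[>] 0) =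
      ENNReal.ofReal a) :
    tailCoef c = ENNReal.ofReal a ∧ tailDegree c = ENNReal.ofReal b := by
  have hpos : ∀ᶠ s : ℝ in 𝓝[>] 0, 0 < s := self_mem_nhdsWithin
  have hlarge : ∀ τ : ℝ≥0, b < τ →
      liminf (fun s : ℝ => c (Set.Icc 0 (fun _ => s)) / ENNReal.ofReal (s ^ (τ : ℝ)))
        (𝓝[>] 0) = ∞ := by
    intro τ hτ
    refine ENNReal.eq_top_of_forall_nnreal_le fun M => le_liminf_of_le (by isBoundedDefault) ?_
    have h1 : ∀ᶠ s : ℝ in 𝓝[>] 0, ENNReal.ofReal (a / 2) <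
        c (Set.Icc 0 (fun _ => s)) / ENNReal.ofReal (s ^ b) := by
      refine eventually_lt_of_lt_liminf ?_
      rw [h]
      exact (ENNReal.ofReal_lt_ofReal_iff ha).2 (half_lt_self ha)
    have h2 : ∀ᶠ s : ℝ in 𝓝[>] 0, (M : ℝ) / (a / 2) ≤ s ^ (b - τ) :=
      (tendsto_rpow_neg_nhdsGT_zero (sub_neg.2 hτ)).eventually_ge_atTop _
    filter_upwards [hpos, h1, h2] with s hs h1 h2
    have hsb : 0 < s ^ b := Real.rpow_pos_of_pos hs _
    have hsτ : 0 < s ^ (τ : ℝ) := Real.rpow_pos_of_pos hs _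
    have h3 := (ENNReal.le_div_iff_mul_le (Or.inl (ENNReal.ofReal_pos.2 hsb).ne')
      (Or.inl ENNReal.ofReal_ne_top)).1 h1.le
    rw [ENNReal.le_div_iff_mul_le (Or.inl (ENNReal.ofReal_pos.2 hsτ).ne')
      (Or.inl ENNReal.ofReal_ne_top)]
    refine le_trans ?_ h3
    rw [← ENNReal.ofReal_coe_nnreal, ← ENNReal.ofReal_mul M.coe_nonneg,
      ← ENNReal.ofReal_mul (half_pos ha).le]
    refine ENNReal.ofReal_le_ofReal ?_
    rw [Real.rpow_sub hs, div_le_div_iff₀ (half_pos ha) hsτ] at h2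
    linarith
  have hsmall : ∀ τ : ℝ≥0,
      liminf (fun s : ℝ => c (Set.Icc 0 (fun _ => s)) / ENNReal.ofReal (s ^ (τ : ℝ)))
        (𝓝[>] 0) = ∞ → b < τ := by
    intro τ hτ
    by_contra! hle
    have h1 : ∃ᶠ s : ℝ in 𝓝[>] 0, c (Set.Icc 0 (fun _ => s)) / ENNReal.ofReal (s ^ b) <
        ENNReal.ofReal (a + 1) := by
      refine frequently_lt_of_liminf_lt (by isBoundedDefault) ?_
      rw [h]
      exact (ENNReal.ofReal_lt_ofReal_iff (by linarith)).2 (by linarith)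
    have hlt1 : ∀ᶠ s : ℝ in 𝓝[>] 0, s < 1 :=
      mem_nhdsWithin_of_mem_nhds (Iio_mem_nhds zero_lt_one)
    have h2 : liminf (fun s : ℝ => c (Set.Icc 0 (fun _ => s)) / ENNReal.ofReal (s ^ (τ : ℝ)))
        (𝓝[>] 0) ≤ ENNReal.ofReal (a + 1) := by
      refine liminf_le_of_frequently_le ((h1.and_eventually (hpos.and hlt1)).mono ?_)
        (by isBoundedDefault)
      rintro s ⟨h1, hs, hs1⟩
      refine (ENNReal.div_le_div_left (ENNReal.ofReal_le_ofReal ?_) _).trans h1.le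
      exact Real.rpow_le_rpow_of_exponent_ge hs hs1.le hle
    rw [hτ] at h2
    exact absurd h2 (not_le.2 ENNReal.ofReal_lt_top)
  have hdeg : tailDegree c = ENNReal.ofReal b := by
    refine le_antisymm (le_of_forall_gt_imp_ge_of_dense fun x hx => ?_) ?_
    · obtain ⟨τ, h1, h2⟩ := ENNReal.lt_iff_exists_nnreal_btwn.1 hx
      refine (iInf₂_le τ (hlarge τ ?_)).trans h2.le
      rwa [← ENNReal.ofReal_coe_nnreal, ENNReal.ofReal_lt_ofReal_iff_of_nonneg hb] at h1
    · refine le_iInf₂ fun τ hτ => ?_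
      rw [← ENNReal.ofReal_coe_nnreal]
      exact ENNReal.ofReal_le_ofReal (hsmall τ hτ).le
  refine ⟨?_, hdeg⟩
  rw [tailCoef, hdeg, if_neg ENNReal.ofReal_ne_top, ENNReal.toReal_ofReal hb, h]

theorem faceMeasure_Icc (c : Measure (Fin r → ℝ)) (F : Finset (Fin r)) (s : ℝ) :
    faceMeasure c F (Set.Icc 0 fun _ => s) = c (cornerSet F s) := by
  rw [faceMeasure, Measure.map_apply (Finset.measurable_restrict F) measurableSet_Icc]
  congr 1
  ext w
  simp only [cornerSet, Set.mem_preimage, ← Set.pi_univ_Icc, Set.mem_univ_pi]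
  constructor
  · intro h i
    by_cases hi : i ∈ F
    · simpa [hi] using h ⟨i, hi⟩
    · simp [hi]
  · intro h i
    simpa using h i

/-- If `c([0,s]^F) / s^b` is a function `R` of the position `l` of `s = t^n (t + (1 - t) l)` between
two consecutive scales, then its lower limit is the minimum of `R`. -/
theorem tailChar_of_log_periodic (t : Set.Ioo (0 : ℝ) 1) {c : Measure (Fin r → ℝ)}
    [IsFiniteMeasure c] {F : Finset (Fin r)} {a b : ℝ} (ha : 0 < a) (hb : 0 ≤ b) {N : ℕ}
    {R : ℝ → ℝ} (hR : ∀ n ≥ N, ∀ l ∈ Set.Icc (0 : ℝ) 1,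
      c.real (cornerSet F ((t : ℝ) ^ n * (t + (1 - t) * l))) =
        R l * ((t : ℝ) ^ n * (t + (1 - t) * l)) ^ b)
    (hmin : ∀ l ∈ Set.Icc (0 : ℝ) 1, a ≤ R l) {l₀ : ℝ} (hl₀ : l₀ ∈ Set.Icc (0 : ℝ) 1)
    (hl₀' : R l₀ = a) : tailChar c F = (ENNReal.ofReal a, ENNReal.ofReal b) := by
  have ht0 : (0 : ℝ) < t := t.2.1
  have ht1 : (t : ℝ) < 1 := t.2.2
  have h1t : (0 : ℝ) < 1 - t := sub_pos.2 ht1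
  suffices h : liminf (fun s : ℝ => faceMeasure c F (Set.Icc 0 (fun _ => s)) /
      ENNReal.ofReal (s ^ b)) (𝓝[>] 0) = ENNReal.ofReal a by
    obtain ⟨h1, h2⟩ := tailCoef_and_tailDegree_of_liminf ha hb h
    rw [tailChar, h1, h2]
  have hval : ∀ n ≥ N, ∀ l ∈ Set.Icc (0 : ℝ) 1,
      faceMeasure c F (Set.Icc 0 (fun _ => (t : ℝ) ^ n * (t + (1 - t) * l))) /
        ENNReal.ofReal (((t : ℝ) ^ n * (t + (1 - t) * l)) ^ b) = ENNReal.ofReal (R l) := by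
    intro n hn l hl
    have hs : 0 < (t : ℝ) ^ n * (t + (1 - t) * l) :=
      mul_pos (pow_pos ht0 n) (add_pos_of_pos_of_nonneg ht0 (mul_nonneg h1t.le hl.1))
    have hsb := Real.rpow_pos_of_pos hs b
    rw [faceMeasure_Icc, ← ofReal_measureReal, hR n hn l hl, ← ENNReal.ofReal_div_of_pos hsb,
      mul_div_cancel_right₀ _ hsb.ne']
  refine le_antisymm ?_ ?_
  · refine liminf_le_of_frequently_le ?_ (by isBoundedDefault)
    have hpos : 0 < (t : ℝ) + (1 - t) * l₀ :=
      add_pos_of_pos_of_nonneg ht0 (mul_nonneg h1t.le hl₀.1)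
    have htend : Tendsto (fun n : ℕ => (t : ℝ) ^ n * (t + (1 - t) * l₀)) atTop (𝓝[>] 0) := by
      refine tendsto_nhdsWithin_iff.2 ⟨?_, Eventually.of_forall fun n => ?_⟩
      · simpa using (tendsto_pow_atTop_nhds_zero_of_lt_one ht0.le ht1).mul_const
          ((t : ℝ) + (1 - t) * l₀)
      · exact mul_pos (pow_pos ht0 n) hpos
    refine htend.frequently (Eventually.frequently ?_)
    filter_upwards [eventually_ge_atTop N] with n hn
    rw [hval n hn l₀ hl₀, hl₀']
  · refine le_liminf_of_le (by isBoundedDefault) ?_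
    filter_upwards [Ioc_mem_nhdsGT (pow_pos ht0 N)] with s hs
    obtain ⟨n, hn1, hn2⟩ := exists_nat_pow_near_of_lt_one hs.1
      (hs.2.trans (pow_le_one₀ ht0.le ht1.le)) ht0 ht1
    have hnN : N ≤ n := by
      by_contra! h
      exact absurd (hn1.trans_le hs.2) (not_lt.2 (pow_le_pow_of_le_one ht0.le ht1.le h))
    have hp : 0 < (t : ℝ) ^ n := pow_pos ht0 n
    obtain ⟨l, hl, rfl⟩ : ∃ l ∈ Set.Icc (0 : ℝ) 1, (t : ℝ) ^ n * (t + (1 - t) * l) = s := by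
      refine ⟨(s / (t : ℝ) ^ n - t) / (1 - t), ⟨?_, ?_⟩, ?_⟩
      · refine div_nonneg (sub_nonneg.2 ?_) h1t.le
        rw [le_div_iff₀ hp, mul_comm, ← pow_succ]
        exact hn1.le
      · rw [div_le_one h1t]
        exact sub_le_sub_right ((div_le_one hp).2 hn2) _
      · field_simp
        ring
    rw [hval n hnN l hl]
    exact ENNReal.ofReal_le_ofReal (hmin l hl)

/-! ### Choice of the vertex copulas -/

/-- The Möbius inverse is positive where one term outweighs all others of the alternating sum. -/
theorem ofAvoidMass_pos {x : Finset (Fin r) → ℝ} {ν : Finset (Fin r)}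
    (h : ∑ H with νᶜ ⊂ H, |x H| < x νᶜ) : 0 < ofAvoidMass x ν := by
  classical
  have hins : (Finset.univ.filter fun H => νᶜ ⊆ H) =
      insert νᶜ (Finset.univ.filter fun H => νᶜ ⊂ H) := by
    ext H
    simp only [Finset.mem_filter, Finset.mem_univ, true_and, Finset.mem_insert]
    rw [Finset.ssubset_iff_subset_ne]
    by_cases hH : H = νᶜ
    · simp [hH]
    · simp [hH, Ne.symm hH]
  rw [ofAvoidMass, hins, Finset.sum_insert (by simp)]
  have h1 : |∑ H with νᶜ ⊂ H, (-1 : ℝ) ^ (H ∩ ν).card * x H| ≤ ∑ H with νᶜ ⊂ H, |x H| := by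
    refine (Finset.abs_sum_le_sum_abs _ _).trans (Finset.sum_le_sum fun H _ => ?_)
    rw [abs_mul, abs_pow, abs_neg, abs_one, one_pow, one_mul]
  have h2 : νᶜ ∩ ν = ∅ := Finset.disjoint_iff_inter_eq_empty.1 disjoint_compl_left
  rw [h2, Finset.card_empty, pow_zero, one_mul]
  linarith [neg_abs_le (∑ H with νᶜ ⊂ H, (-1 : ℝ) ^ (H ∩ ν).card * x H)]

theorem exists_sum_rpow_lt {b : Finset (Fin r) → ℝ} (hb : ∀ F F', F ⊂ F' → b F < b F') :
    ∃ t : Set.Ioo (0 : ℝ) 1, ∀ B, ∑ H with B ⊂ H, (t : ℝ) ^ b H < (t : ℝ) ^ b B := by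
  have h : ∀ᶠ t : ℝ in 𝓝[>] 0, ∀ B, ∑ H with B ⊂ H, t ^ (b H - b B) < 1 := by
    refine eventually_all.2 fun B => ?_
    have hlim : Tendsto (fun t : ℝ => ∑ H with B ⊂ H, t ^ (b H - b B)) (𝓝[>] 0)
        (𝓝 (∑ H with B ⊂ H, 0)) := by
      refine tendsto_finsetSum _ fun H hH => ?_
      have hpos : 0 < b H - b B := sub_pos.2 (hb _ _ (Finset.mem_filter.1 hH).2)
      have := (Real.continuousAt_rpow_const 0 (b H - b B) (Or.inr hpos.le)).tendsto
      rw [Real.zero_rpow hpos.ne'] at this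
      exact this.mono_left nhdsWithin_le_nhds
    rw [Finset.sum_const_zero] at hlim
    exact hlim.eventually_lt_const zero_lt_one
  obtain ⟨t, ht, hlt⟩ := (h.and (Ioo_mem_nhdsGT zero_lt_one)).exists
  refine ⟨⟨t, hlt⟩, fun B => ?_⟩
  have hB : 0 < t ^ b B := Real.rpow_pos_of_pos hlt.1 _
  have := mul_lt_mul_of_pos_right (ht B) hB
  rw [one_mul, Finset.sum_mul] at this
  refine lt_of_eq_of_lt (Finset.sum_congr rfl fun H _ => ?_) this
  change t ^ b H = _
  rw [← Real.rpow_add hlt.1, sub_add_cancel]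

/-- Strict positivity survives a small multiplicative perturbation: a prescribed factor can be
distributed over sufficiently many steps. -/
theorem exists_root_sum_lt {x y : Finset (Fin r) → ℝ} (hx : ∀ H, 0 < x H) (hy : ∀ H, 0 < y H)
    (h : ∀ B, ∑ H with B ⊂ H, x H < x B) :
    ∃ N : ℕ, N ≠ 0 ∧ ∀ B, ∑ H with B ⊂ H, |y H ^ ((N : ℝ)⁻¹) * x H| < y B ^ ((N : ℝ)⁻¹) * x B := by
  have hlim : ∀ H, Tendsto (fun N : ℕ => y H ^ ((N : ℝ)⁻¹) * x H) atTop (𝓝 (x H)) := by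
    intro H
    have h1 := (Real.continuousAt_const_rpow (b := 0) (hy H).ne').tendsto.comp
      (tendsto_inv_atTop_nhds_zero_nat (𝕜 := ℝ))
    rw [Real.rpow_zero] at h1
    simpa using h1.mul_const (x H)
  have hev : ∀ᶠ N : ℕ in atTop, ∀ B,
      ∑ H with B ⊂ H, |y H ^ ((N : ℝ)⁻¹) * x H| < y B ^ ((N : ℝ)⁻¹) * x B := by
    refine eventually_all.2 fun B => ?_
    refine (tendsto_finsetSum _ fun H _ => (hlim H).abs).eventually_lt (hlim B) ?_
    simpa only [abs_of_pos (hx _)] using h B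
  obtain ⟨N, h1, h2⟩ := (hev.and (eventually_ne_atTop 0)).exists
  exact ⟨N, h2, h1⟩

theorem tailPoly_of_avoidMass {k : ℕ} {t : ℝ} {z : Finset (Fin r) → ℝ}
    (hz : ∀ G : Finset (Fin r), G.card ≤ k → avoidMass z G = t ^ G.card)
    {F : Finset (Fin r)} (hF : F.card ≤ k) (l : ℝ) : tailPoly z F l = (t + (1 - t) * l) ^ F.card := by
  have h := sum_mul_prod_of_avoidMass hz hF (fun i => if i ∈ F then l else 1) (fun _ => 1)
    fun i hi => by simp [hi]
  have e1 : ∀ ν : Finset (Fin r), ∏ i, (if i ∈ ν then (if i ∈ F then l else 1) else 1) =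
      l ^ (ν ∩ F).card := by
    intro ν
    rw [Finset.prod_ite_mem, Finset.univ_inter, Finset.prod_ite_mem, Finset.prod_const]
  simp only [e1] at h
  rw [tailPoly, h, ← Finset.prod_const, ← Finset.prod_subset (Finset.subset_univ F)]
  · refine Finset.prod_congr rfl fun i hi => ?_
    rw [if_pos hi]
    ring
  · intro i _ hi
    rw [if_neg hi]
    ring

theorem tailPoly_pos {z : Finset (Fin r) → ℝ} (h0 : ∀ ν, 0 ≤ z ν) {F : Finset (Fin r)}
    (hF : 0 < avoidMass z F) {l : ℝ} (hl : 0 ≤ l) : 0 < tailPoly z F l := by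
  refine hF.trans_le ?_
  rw [← tailPoly_zero]
  exact Finset.sum_le_sum fun ν _ =>
    mul_le_mul_of_nonneg_left (pow_le_pow_left₀ le_rfl hl _) (h0 ν)

end TailNesting

end

/-! ### The tail nesting with prescribed tail characteristic -/

theorem mainTheorem1 (r k : ℕ) (hk : 1 ≤ k) (hkr : k ≤ r) (a b : Finset (Fin r) → ℝ)
    (ha : ∀ F, 0 < a F) (hNC : TailNesting.NC k a b)
    (hb : ∀ F F' : Finset (Fin r), F ⊂ F' → b F < b F') :
    ∃ (t : Set.Ioo (0 : ℝ) 1) (z : ℕ → Finset (Fin r) → ℝ),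
      (∀ n, z n ∈ TailNesting.vertexCopulas k (fun _ : Fin r => t)) ∧
      ∃ c : MeasureTheory.Measure (Fin r → ℝ),
        TailNesting.IsTailNesting (fun _ _ => t) z c ∧
        TailNesting.IsCopulaOfOrder k c ∧
        TailNesting.LocallyPiecewiseUniformOn c {w | ∀ i, w i ∈ Set.Ioo (0 : ℝ) 1} ∧
        ∀ F : Finset (Fin r),
          TailNesting.tailChar c F = (ENNReal.ofReal (a F), ENNReal.ofReal (b F)) := by
  open TailNesting in
  obtain ⟨t, ht⟩ := exists_sum_rpow_lt hb
  have ht0 : (0 : ℝ) < t := t.2.1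
  have h1t : (0 : ℝ) < 1 - t := sub_pos.2 t.2.2
  set x : Finset (Fin r) → ℝ := fun F => (t : ℝ) ^ b F with hx
  have hxpos : ∀ F, 0 < x F := fun F => Real.rpow_pos_of_pos ht0 _
  have hxk : ∀ G : Finset (Fin r), G.card ≤ k → x G = (t : ℝ) ^ G.card := by
    intro G hG
    rw [hx]
    change (t : ℝ) ^ b G = _
    rw [(hNC.low_dim G hG).2, Real.rpow_natCast]
  -- `w` is the vertex copula of all but finitely many steps.
  set w := ofAvoidMass x with hw
  have hw0 : ∀ ν, 0 ≤ w ν := fun ν => (ofAvoidMass_pos (by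
    simpa only [abs_of_pos (hxpos _)] using ht νᶜ)).le
  have hwx : ∀ F, avoidMass w F = x F := avoidMass_ofAvoidMass x
  have hbase : ∀ l ∈ Set.Icc (0 : ℝ) 1, 0 < (t : ℝ) + (1 - t) * l := fun l hl =>
    add_pos_of_pos_of_nonneg ht0 (mul_nonneg h1t.le hl.1)
  set R : Finset (Fin r) → ℝ → ℝ := fun F l => tailPoly w F l / (t + (1 - t) * l) ^ b F with hRdef
  have hRpos : ∀ F, ∀ l ∈ Set.Icc (0 : ℝ) 1, 0 < R F l := fun F l hl =>
    div_pos (tailPoly_pos hw0 ((hwx F).symm ▸ hxpos F) hl.1) (Real.rpow_pos_of_pos (hbase l hl) _)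
  have hmin : ∀ F, ∃ l ∈ Set.Icc (0 : ℝ) 1, IsMinOn (R F) (Set.Icc 0 1) l := by
    intro F
    refine isCompact_Icc.exists_isMinOn (Set.nonempty_Icc.2 zero_le_one) ?_
    refine ContinuousOn.div ?_ ?_ fun l hl => (Real.rpow_pos_of_pos (hbase l hl) _).ne'
    · unfold tailPoly
      fun_prop
    · exact ContinuousOn.rpow_const (by fun_prop) fun l hl => Or.inl (hbase l hl).ne'
  choose l₀ hl₀ hl₀min using hmin
  -- The limit of `c([0,t^n]^F) / t^(n b(F))` has to be `y F` for the lower limit over all scales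
  -- to be `a F`.
  set y : Finset (Fin r) → ℝ := fun F => a F / R F (l₀ F) with hy
  have hypos : ∀ F, 0 < y F := fun F => div_pos (ha F) (hRpos F _ (hl₀ F))
  have hyk : ∀ G : Finset (Fin r), G.card ≤ k → y G = 1 := by
    intro G hG
    have hR1 : R G (l₀ G) = 1 := by
      change tailPoly w G (l₀ G) / _ = 1
      rw [tailPoly_of_avoidMass (fun G hG => (hwx G).trans (hxk G hG)) hG, (hNC.low_dim G hG).2,
        Real.rpow_natCast, div_self (pow_pos (hbase _ (hl₀ G)) _).ne']
    change a G / R G (l₀ G) = 1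
    rw [hR1, (hNC.low_dim G hG).1, div_one]
  obtain ⟨N, hN, hNlt⟩ := exists_root_sum_lt hxpos hypos ht
  -- `v` is used in the first `N` steps, which together contribute the factor `y`.
  set v := ofAvoidMass fun F => y F ^ ((N : ℝ)⁻¹) * x F with hv
  have hv0 : ∀ ν, 0 ≤ v ν := fun ν => (ofAvoidMass_pos (hNlt νᶜ)).le
  have hvx : ∀ F, avoidMass v F = y F ^ ((N : ℝ)⁻¹) * x F := avoidMass_ofAvoidMass _
  set z : ℕ → Finset (Fin r) → ℝ := fun n => if n < N then v else w with hz
  have hz0 : ∀ n ν, 0 ≤ z n ν := by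
    intro n ν
    simp only [hz]
    split_ifs
    exacts [hv0 ν, hw0 ν]
  have hzk : ∀ n (G : Finset (Fin r)), G.card ≤ k → avoidMass (z n) G = (t : ℝ) ^ G.card := by
    intro n G hG
    simp only [hz]
    split_ifs
    · rw [hvx, hyk G hG, Real.one_rpow, one_mul, hxk G hG]
    · rw [hwx, hxk G hG]
  have hprod : ∀ F, ∀ n ≥ N, ∏ j ∈ Finset.range n, avoidMass (z j) F = y F * x F ^ n := by
    intro F n hn
    obtain ⟨d, rfl⟩ := Nat.exists_eq_add_of_le hn
    have e1 : ∀ j ∈ Finset.range N, avoidMass (z j) F = y F ^ ((N : ℝ)⁻¹) * x F := by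
      intro j hj
      simp only [hz, if_pos (Finset.mem_range.1 hj), hvx]
    have e2 : ∀ j ∈ Finset.range d, avoidMass (z (N + j)) F = x F := by
      intro j _
      simp only [hz, if_neg (Nat.not_lt.2 (Nat.le_add_right N j)), hwx]
    rw [Finset.prod_range_add, Finset.prod_congr rfl e1, Finset.prod_congr rfl e2,
      Finset.prod_const, Finset.prod_const, Finset.card_range, Finset.card_range, mul_pow,
      Real.rpow_inv_natCast_pow (hypos F).le hN, pow_add, mul_assoc]
  have hprob := isProbabilityMeasure_limitMeas t hk hz0 hzk
  refine ⟨t, z, fun n => mem_vertexCopulas_of_avoidMass t (hz0 n) (hzk n), limitMeas t z,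
    isTailNesting_limitMeas t hk hz0 hzk, isCopulaOfOrder_limitMeas t hk hz0 hzk,
    locallyPiecewiseUniformOn_limitMeas t hz0 (sum_eq_one_of_avoidMass t hzk), fun F => ?_⟩
  have hbF : 0 ≤ b F := by
    have h0 := (hNC.low_dim ∅ (by simp)).2
    rw [Finset.card_empty, Nat.cast_zero] at h0
    rw [← h0]
    exact hNC.mono _ _ (Finset.empty_subset F)
  refine tailChar_of_log_periodic t (ha F) hbF (N := N) (R := fun l => y F * R F l) ?_ ?_
    (hl₀ F) (div_mul_cancel₀ _ (hRpos F _ (hl₀ F)).ne')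
  · intro n hn l hl
    have hzn : z n = w := if_neg (not_lt.2 hn)
    have hpb : ((t : ℝ) ^ n) ^ b F = x F ^ n := by
      rw [hx]
      change _ = ((t : ℝ) ^ b F) ^ n
      rw [← Real.rpow_natCast, ← Real.rpow_natCast, ← Real.rpow_mul ht0.le, ← Real.rpow_mul ht0.le,
        mul_comm]
    rw [limitMeas_real_cornerSet t hk hz0 hzk F n hl.1 hl.2, hprod F n hn, hzn,
      Real.mul_rpow (pow_pos ht0 n).le (hbase l hl).le, hpb]
    have hne := (Real.rpow_pos_of_pos (hbase l hl) (b F)).ne'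
    simp only [hRdef]
    field_simp
  · intro l hl
    have h1 : a F = y F * R F (l₀ F) := (div_mul_cancel₀ _ (hRpos F _ (hl₀ F)).ne').symm
    rw [h1]
    exact mul_le_mul_of_nonneg_left (hl₀min F hl) (hypos F).le
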